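/- Let $m\ge 0$, let $V'=\mathbb C^m$ and let $G'\subset \mathrm{GL}(m,\mathbb C)=\mathrm{GL}(V')$ be a finite subgroup. Let $f:\mathrm{GL}(m,\mathbb C)\to \mathrm{SL}(m+1,\mathbb C)$ be the embedding $g\mapsto \mathrm{diag}(g,\det(g)^{-1})$, and let $G=f(G')$. For a finite subgroup $H\subset\mathrm{GL}(n,\mathbb C)$ with complete set of irreducible complex representations $\{S_i\}$, the McKay quiver $Q_H$ has as vertices the isomorphism classes of the $S_i$, and has $a_{ij}$ arrows from $i$ to $j$, where $\mathbb C^n\otimes S_i\cong\bigoplus_j S_j^{a_{ij}}$. Let $A=\bigwedge V' * G'$ be the skew group algebra of $G'$ over the exterior algebra of $V'$. Let $e_1,\dots,e_r\in A$ be orthogonal primitive idempotents such that the left modules $Ae_1,\dots,Ae_r$ form a complete set of representatives of the isomorphism classes of indecomposable finitely generated projective left $A$-modules, put $e=e_1+\dots+e_r$, and let $\Lambda(G')=eAe$ be the basic algebra of $A$. A vertex $i$ of $Q_{G'}$ is identified with the simple $\Lambda(G')$-module $eS_i$, where $S_i$ is regarded as an $A$-module on which $V'$ acts as $0$. Then there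 is a unique permutation $\sigma$ of the vertices of $Q_{G'}$ (the Nakayama permutation of $\Lambda(G')$) such that, for every vertex $i$, the socle of the projective cover of $eS_i$ is isomorphic to $eS_{\sigma i}$. Identify the vertices of $Q_G$ with those of $Q_{G'}$ by pulling representations back along the isomorphism $f:G'\to G$. Then the McKay quiver $Q_G$ is obtained from $Q_{G'}$ by adding, for each vertex $i$ of $Q_{G'}$, one arrow from $\sigma i$ to $i$; that is, there is an isomorphism from $Q_G$ to the quiver so obtained which on vertices is this identification. -/

import Mathlib

open scoped TensorProduct DirectSum MonoidAlgebra MatrixGroups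

noncomputable section

/-! ### Irreducible representations of a group and multiplicities -/

/-- A finite-dimensional irreducible complex representation of `G`. -/
structure IrrRep (G : Type) [Group G] where
  V : Type
  [addCommGroup : AddCommGroup V]
  [module : Module ℂ V]
  [finiteDimensional : FiniteDimensional ℂ V]
  ρ : Representation ℂ G V
  irreducible : ρ.IsIrreducible

attribute [instance] IrrRep.addCommGroup IrrRep.module IrrRep.finiteDimensional
  IrrRep.irreducible

/-- Isomorphism of representations as an equivalence relation on irreducible representations. -/
instance IrrRep.isoSetoid (G : Type) [Group G] : Setoid (IrrRep G) where
  r S T := Nonempty (S.ρ.Equiv T.ρ)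
  iseqv := ⟨fun S => ⟨.refl S.ρ⟩, fun ⟨a⟩ => ⟨a.symm⟩, fun ⟨a⟩ ⟨b⟩ => ⟨a.trans b⟩⟩

/-- The set of isomorphism classes of irreducible complex representations of `G`. -/
def Irr (G : Type) [Group G] : Type 1 := Quotient (IrrRep.isoSetoid G)

/-- A chosen representative of an isomorphism class, so that `i ↦ i.rep` is a complete set of
irreducible representations. -/
def Irr.rep {G : Type} [Group G] (i : Irr G) : IrrRep G := Quotient.out i

/-- Pullback of an irreducible representation along an isomorphism of groups. -/
def IrrRep.pullback {G H : Type} [Group G] [Group H] (φ : G ≃* H) (S : IrrRep H) : IrrRep G where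
  V := S.V
  ρ := S.ρ.comp φ.toMonoidHom
  irreducible := by
    have h := S.irreducible
    let F : Subrepresentation S.ρ ≃o Subrepresentation (S.ρ.comp φ.toMonoidHom) :=
      { toFun := fun W => ⟨W.toSubmodule, fun g v hv => W.apply_mem_toSubmodule (φ g) hv⟩
        invFun := fun W => ⟨W.toSubmodule, fun g v hv => by
          have := W.apply_mem_toSubmodule (φ.symm g) hv
          simpa using this⟩
        left_inv := fun _ => rfl
        right_inv := fun _ => rfl
        map_rel_iff' := Iff.rfl }
    exact F.symm.isSimpleOrder_iff.mpr h

/-- The bijection between isomorphism classes of irreducible representations induced by an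
isomorphism of groups `φ : G ≃* H`, sending the class of `ρ` to the class of `ρ ∘ φ`. -/
def Irr.pullback {G H : Type} [Group G] [Group H] (φ : G ≃* H) : Irr H ≃ Irr G where
  toFun := Quotient.map (IrrRep.pullback φ) fun _ _ ⟨a⟩ =>
    ⟨.mk a.toLinearEquiv fun g => a.isIntertwining' (φ g)⟩
  invFun := Quotient.map (IrrRep.pullback φ.symm) fun _ _ ⟨a⟩ =>
    ⟨.mk a.toLinearEquiv fun g => a.isIntertwining' (φ.symm g)⟩
  left_inv := by
    rintro ⟨S⟩
    refine Quotient.sound ⟨.mk (LinearEquiv.refl ℂ S.V) fun g => LinearMap.ext fun v => ?_⟩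
    change S.ρ (φ (φ.symm g)) v = S.ρ g v
    rw [φ.apply_symm_apply]
  right_inv := by
    rintro ⟨S⟩
    refine Quotient.sound ⟨.mk (LinearEquiv.refl ℂ S.V) fun g => LinearMap.ext fun v => ?_⟩
    change S.ρ (φ.symm (φ g)) v = S.ρ g v
    rw [φ.symm_apply_apply]

/-- `a` is the family of multiplicities of a decomposition `ρ ≅ ⨁ⱼ a j • Sⱼ` of `ρ` as a direct
sum of irreducible representations. -/
def IsDecomposition {G W : Type} [Group G] [AddCommGroup W] [Module ℂ W]
    (ρ : Representation ℂ G W) (a : Irr G → ℕ) : Prop :=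
  Nonempty (ρ.Equiv
    (Representation.directSum fun p : (Σ j : Irr G, Fin (a j)) => p.1.rep.ρ))

theorem Subrepresentation.isIrreducible_of_isAtom {G W : Type} [Group G] [AddCommGroup W]
    [Module ℂ W] {ρ : Representation ℂ G W} {U : Subrepresentation ρ} (hU : IsAtom U) :
    U.toRepresentation.IsIrreducible := by
  have hne : ∃ w : W, w ∈ U.toSubmodule ∧ w ≠ 0 := by
    by_contra! h
    exact hU.1 (Subrepresentation.ext ((Submodule.eq_bot_iff _).mpr h))
  obtain ⟨w, hw, hw0⟩ := hne
  refine { exists_pair_ne := ⟨⊥, ⊤, fun h => hw0 ?_⟩, eq_bot_or_eq_top := fun X => ?_ }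
  · have : (⟨w, hw⟩ : U.toSubmodule) ∈ (⊥ : Subrepresentation U.toRepresentation).toSubmodule := by
      rw [h]; exact Submodule.mem_top
    exact congrArg Subtype.val ((Submodule.mem_bot ℂ).mp this)
  · let Y : Subrepresentation ρ :=
      ⟨X.toSubmodule.map U.toSubmodule.subtype, by
        rintro g _ ⟨x, hx, rfl⟩
        exact ⟨_, X.apply_mem_toSubmodule g hx, rfl⟩⟩
    have hY : Y ≤ U := by
      rintro _ ⟨x, -, rfl⟩
      exact x.2
    rcases hU.le_iff.mp hY with h | h
    · left
      refine Subrepresentation.ext ((Submodule.eq_bot_iff _).mpr fun x hx => ?_)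
      have : x.1 ∈ Y.toSubmodule := ⟨x, hx, rfl⟩
      rw [h] at this
      exact Subtype.ext ((Submodule.mem_bot ℂ).mp this)
    · right
      refine Subrepresentation.ext (Submodule.eq_top_iff'.mpr fun x => ?_)
      have : x.1 ∈ Y.toSubmodule := by rw [h]; exact x.2
      obtain ⟨y, hy, hyx⟩ := this
      rwa [← Subtype.ext hyx]

theorem exists_isDecomposition {G W : Type} [Group G] [Finite G] [AddCommGroup W] [Module ℂ W]
    [FiniteDimensional ℂ W] (ρ : Representation ℂ G W) : ∃ a : Irr G → ℕ, IsDecomposition ρ a := by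
  classical
  have : NeZero (Nat.card G : ℂ) := ⟨by simpa using Nat.card_pos.ne'⟩
  have : Module.Finite ℂ ρ.asModule := inferInstanceAs (Module.Finite ℂ W)
  have : Module.Finite ℂ[G] ρ.asModule := Module.Finite.of_restrictScalars_finite ℂ _ _
  obtain ⟨n, S, e, hS⟩ :=
    IsSemisimpleModule.exists_linearEquiv_fin_dfinsupp ℂ[G] ρ.asModule
  let U : Fin n → Subrepresentation ρ := fun i =>
    Subrepresentation.subrepresentationSubmoduleOrderIso.symm (S i)
  have hU : ∀ i, IsAtom (U i) := fun i =>
    (OrderIso.isAtom_iff _ _).mpr (isSimpleModule_iff_isAtom.mp (hS i))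
  let T : Fin n → IrrRep G := fun i =>
    { V := (U i).toSubmodule
      ρ := (U i).toRepresentation
      irreducible := Subrepresentation.isIrreducible_of_isAtom (hU i) }
  let c : Fin n → Irr G := fun i => Quotient.mk _ (T i)
  have hc : ∀ i, Nonempty ((T i).ρ.Equiv (c i).rep.ρ) := fun i =>
    Setoid.symm (Quotient.mk_out (T i))
  have hsmul : ∀ (i : Fin n) (r : ℂ[G]) (w : W),
      (((e (r • (show ρ.asModule from w))) i : S i) : ρ.asModule) =
        r • ((e (show ρ.asModule from w) i : S i) : ρ.asModule) := fun i r w => by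
    rw [e.map_smul]; rfl
  let E₀ : W ≃ₗ[ℂ] ⨁ i, (T i).V :=
    { toFun := fun w => e w
      map_add' := fun x y => e.map_add x y
      map_smul' := fun r x => by
        refine DFinsupp.ext fun i => Subtype.ext ?_
        have h := hsmul i (algebraMap ℂ ℂ[G] r) x
        rw [algebraMap_smul, algebraMap_smul] at h
        exact h
      invFun := fun x => e.symm x
      left_inv := e.left_inv
      right_inv := e.right_inv }
  have E : ρ.Equiv (Representation.directSum fun i => (T i).ρ) := by
    refine .mk E₀ fun g => LinearMap.ext fun w => DFinsupp.ext fun i => Subtype.ext ?_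
    have h := hsmul i (MonoidAlgebra.single g 1) w
    rw [Representation.single_smul, Representation.single_smul, one_smul, one_smul] at h
    exact h
  let m : Irr G → ℕ := fun j => Fintype.card {i // c i = j}
  let r : (Σ j, Fin (m j)) ≃ Fin n :=
    (Equiv.sigmaCongrRight fun j => (Fintype.equivFin {i // c i = j}).symm).trans
      (Equiv.sigmaFiberEquiv c)
  have hr : ∀ p, c (r p) = p.1 := fun p => ((Fintype.equivFin {i // c i = p.1}).symm p.2).2
  have hq : ∀ p, Nonempty ((T (r p)).ρ.Equiv p.1.rep.ρ) := fun p => hr p ▸ hc (r p)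
  let q := fun p => (hq p).some
  let L : (⨁ i, (T i).V) ≃ₗ[ℂ] ⨁ p : (Σ j, Fin (m j)), p.1.rep.V :=
    (DirectSum.lequivCongrLeft ℂ r.symm).trans
      (DFinsupp.mapRange.linearEquiv fun p => (q p).toLinearEquiv)
  refine ⟨m, ⟨E.trans (.mk L fun g => LinearMap.ext fun x => DFinsupp.ext fun p => ?_)⟩⟩
  exact LinearMap.congr_fun ((q p).isIntertwining' g) (x (r p))

/-- The multiplicity `a j` of `Sⱼ` in the decomposition `ρ ≅ ⨁ⱼ a j • Sⱼ`. -/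
def irrMultiplicity {G W : Type} [Group G] [Finite G] [AddCommGroup W] [Module ℂ W]
    [FiniteDimensional ℂ W] (ρ : Representation ℂ G W) : Irr G → ℕ :=
  (exists_isDecomposition ρ).choose

/-! ### Quivers and the McKay quiver -/

/-- The natural representation of a subgroup of `GL(n, ℂ)` on `ℂⁿ`. -/
def naturalRep {n : ℕ} (G : Subgroup (GL (Fin n) ℂ)) : Representation ℂ G (Fin n → ℂ) where
  toFun g := Matrix.mulVecLin (g : GL (Fin n) ℂ).val
  map_one' := by ext; simp
  map_mul' g h := by ext; simp

/-- The McKay quiver of a finite subgroup `G` of `GL(n, ℂ)`: vertices are the isomorphism classes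
of irreducible representations, and there are `a i j` arrows from `i` to `j`, where
`ℂⁿ ⊗ Sᵢ ≅ ⨁ⱼ a i j • Sⱼ`. -/
abbrev mckayQuiver {n : ℕ} (G : Subgroup (GL (Fin n) ℂ)) [Finite G] : Quiver.{0} (Irr G) where
  Hom i j := Fin (irrMultiplicity ((naturalRep G).tprod i.rep.ρ) j)

/-- The quiver obtained from `Q` by adding, for each vertex `k`, one arrow from `σ k` to `k`. -/
abbrev Quiver.addArrows {Q₀ : Type 1} (Q : Quiver.{0} Q₀) (σ : Q₀ → Q₀) : Quiver.{1} Q₀ where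
  Hom i j := Q.Hom i j ⊕ {k : Q₀ // σ k = i ∧ k = j}

/-- An isomorphism of quivers. -/
structure QuiverIso {Q₀ R₀ : Type*} (Q : Quiver Q₀) (R : Quiver R₀) where
  onVertices : Q₀ ≃ R₀
  onArrows (i j : Q₀) : Q.Hom i j ≃ R.Hom (onVertices i) (onVertices j)

/-! ### Socles, projective covers and the Nakayama permutation -/

/-- The socle of a module: the sum of its simple submodules. -/
def moduleSocle (R M : Type*) [Ring R] [AddCommGroup M] [Module R M] : Submodule R M :=
  sSup {N : Submodule R M | IsSimpleModule R N}

/-- `π : P → M` is a projective cover: `P` is projective and `π` is surjective with superfluous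
kernel. -/
structure IsProjectiveCover {R P M : Type*} [Ring R] [AddCommGroup P] [Module R P]
    [AddCommGroup M] [Module R M] (π : P →ₗ[R] M) : Prop where
  projective : Module.Projective R P
  surjective : Function.Surjective π
  superfluous : ∀ N : Submodule R P, N ⊔ LinearMap.ker π = ⊤ → N = ⊤

/-- Let `simple` be the family of simple `Λ`-modules, indexed by the vertices of the quiver of `Λ`.
A permutation `σ` of the vertices is the Nakayama permutation of `Λ` if for each vertex `i` the
socle of the projective cover of the simple module at `i` is the simple module at `σ i`. -/
def IsNakayamaPermutation {Λ : Type} [Ring Λ] {Q₀ : Type*} (simple : Q₀ → ModuleCat.{0} Λ)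
    (σ : Equiv.Perm Q₀) : Prop :=
  ∀ i, ∃ (P : ModuleCat.{0} Λ) (π : P →ₗ[Λ] simple i),
    IsProjectiveCover π ∧ Nonempty (moduleSocle Λ P ≃ₗ[Λ] simple (σ i))

/-! ### Basic algebras -/

/-- A primitive idempotent of a ring. -/
def IsPrimitiveIdempotent {A : Type*} [Ring A] (e : A) : Prop :=
  IsIdempotentElem e ∧ e ≠ 0 ∧
    ∀ a b : A, IsIdempotentElem a → IsIdempotentElem b → a * b = 0 → b * a = 0 → a + b = e →
      a = 0 ∨ b = 0

/-- An indecomposable module. -/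
def IsIndecomposableModule (R M : Type*) [Ring R] [AddCommGroup M] [Module R M] : Prop :=
  Nontrivial M ∧ ∀ N N' : Submodule R M, IsCompl N N' → N = ⊥ ∨ N' = ⊥

/-- Orthogonal primitive idempotents `e i` such that the left modules `A e i` form a complete set of
representatives of the isomorphism classes of indecomposable (finitely generated) projective left
`A`-modules. The algebra `e A e` with `e = ∑ i, e i` is then the basic algebra of `A`. -/
structure IsBasicSystem {A : Type} [Ring A] {ι : Type} (e : ι → A) : Prop where
  orthogonal : OrthogonalIdempotents e
  primitive : ∀ i, IsPrimitiveIdempotent (e i)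
  irredundant : ∀ i j, Nonempty (Ideal.span {e i} ≃ₗ[A] Ideal.span {e j}) → i = j
  complete : ∀ P : ModuleCat.{0} A, Module.Finite A P → Module.Projective A P →
    IsIndecomposableModule A P → ∃ i, Nonempty (P ≃ₗ[A] Ideal.span {e i})

theorem IsBasicSystem.isIdempotentElem {A : Type} [Ring A] {ι : Type} [Fintype ι] {e : ι → A}
    (he : IsBasicSystem e) : IsIdempotentElem (∑ i, e i) :=
  he.orthogonal.isIdempotentElem_sum

/-- The basic algebra `e A e`, `e = ∑ i, e i`. -/
abbrev IsBasicSystem.basicAlgebra {A : Type} [Ring A] {ι : Type} [Fintype ι] {e : ι → A}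
    (he : IsBasicSystem e) : Type := he.isIdempotentElem.Corner

/-- For an idempotent `e` of `A` and an `A`-module `M`, the subgroup `e M` of `M`. -/
def cornerSubgroup {A : Type} [Ring A] (e : A) (M : Type) [AddCommGroup M] [Module A M] :
    AddSubgroup M := (DistribSMul.toAddMonoidHom M e).range

/-- The `e A e`-module structure on `e M`, by restricting the action of `A`. -/
instance cornerModule {A : Type} [Ring A] {e : A} (he : IsIdempotentElem e) (M : Type)
    [AddCommGroup M] [Module A M] : Module he.Corner (cornerSubgroup e M) where
  smul a x := ⟨a.1 • x.1, a.1 • x.1, by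
    have := ((Subsemigroup.mem_corner_iff he).mp a.2).1
    simp [smul_smul, this]⟩
  one_smul x := Subtype.ext <| by
    obtain ⟨_, y, rfl⟩ := x
    change e • e • y = e • y
    rw [smul_smul, he.eq]
  mul_smul a b x := Subtype.ext (mul_smul a.1 b.1 x.1)
  smul_zero a := Subtype.ext (smul_zero a.1)
  smul_add a x y := Subtype.ext (smul_add a.1 x.1 y.1)
  add_smul a b x := Subtype.ext (add_smul a.1 b.1 x.1)
  zero_smul x := Subtype.ext (zero_smul A x.1)

/-! ### The skew group algebra over the exterior algebra -/

/-- The natural action of `GL(n, ℂ)` (hence of its subgroups) on the exterior algebra of `ℂⁿ`. -/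
instance exteriorAction (n : ℕ) :
    MulSemiringAction (GL (Fin n) ℂ) (ExteriorAlgebra ℂ (Fin n → ℂ)) where
  smul g x := ExteriorAlgebra.map (Matrix.mulVecLin g.val) x
  one_smul x := by
    change ExteriorAlgebra.map (Matrix.mulVecLin (1 : Matrix (Fin n) (Fin n) ℂ)) x = x
    rw [Matrix.mulVecLin_one, ExteriorAlgebra.map_id]; rfl
  mul_smul g h x := by
    change ExteriorAlgebra.map (Matrix.mulVecLin (g.val * h.val)) x =
      ExteriorAlgebra.map _ (ExteriorAlgebra.map _ x)
    rw [Matrix.mulVecLin_mul, ← ExteriorAlgebra.map_comp_map]; rfl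
  smul_zero g := map_zero (ExteriorAlgebra.map (Matrix.mulVecLin g.val))
  smul_add g := map_add (ExteriorAlgebra.map (Matrix.mulVecLin g.val))
  smul_one g := map_one (ExteriorAlgebra.map (Matrix.mulVecLin g.val))
  smul_mul g := map_mul (ExteriorAlgebra.map (Matrix.mulVecLin g.val))

/-- The skew group algebra `⋀ℂⁿ * G`, with multiplication `(x g) (y h) = x (g • y) (g h)`. -/
abbrev SkewGroupAlgebra {n : ℕ} (G : Subgroup (GL (Fin n) ℂ)) : Type :=
  SkewMonoidAlgebra (ExteriorAlgebra ℂ (Fin n → ℂ)) G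

theorem algebraMapInv_smul {n : ℕ} (g : GL (Fin n) ℂ) (x : ExteriorAlgebra ℂ (Fin n → ℂ)) :
    ExteriorAlgebra.algebraMapInv (g • x) = ExteriorAlgebra.algebraMapInv x := by
  have : (ExteriorAlgebra.algebraMapInv (R := ℂ) (M := Fin n → ℂ)).comp
      (ExteriorAlgebra.map (Matrix.mulVecLin g.val)) = ExteriorAlgebra.algebraMapInv := by
    ext v
    simp [ExteriorAlgebra.algebraMapInv]
  exact DFunLike.congr_fun this x

/-- A representation of `G` regarded as a representation of `⋀ℂⁿ * G`, on which `ℂⁿ` acts as `0`: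
`x g` acts as `ε(x) • ρ g`, where `ε` is the projection of `⋀ℂⁿ` to its degree `0` part `ℂ`. -/
def inflate {n : ℕ} {G : Subgroup (GL (Fin n) ℂ)} {V : Type} [AddCommGroup V] [Module ℂ V]
    (ρ : Representation ℂ G V) : SkewGroupAlgebra G →+* Module.End ℂ V :=
  SkewMonoidAlgebra.liftNCRingHom
    ((algebraMap ℂ (Module.End ℂ V)).comp
      (ExteriorAlgebra.algebraMapInv (R := ℂ) (M := Fin n → ℂ) : _ →+* ℂ)) ρ
    (by
      intro x y
      change algebraMap ℂ (Module.End ℂ V) (ExteriorAlgebra.algebraMapInv (y.1 • x)) * ρ y =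
        ρ y * algebraMap ℂ (Module.End ℂ V) (ExteriorAlgebra.algebraMapInv x)
      rw [algebraMapInv_smul, Algebra.commutes])

/-- The simple module of the basic algebra `Λ(G) = e (⋀ℂⁿ * G) e` that belongs to the vertex `i` of
the McKay quiver: `e Sᵢ`, where `Sᵢ` is regarded as a `⋀ℂⁿ * G`-module on which `ℂⁿ` acts as `0`. -/
def vertexSimple {n : ℕ} {G : Subgroup (GL (Fin n) ℂ)} {ι : Type} [Fintype ι]
    {e : ι → SkewGroupAlgebra G} (he : IsBasicSystem e) (i : Irr G) :
    ModuleCat.{0} he.basicAlgebra :=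
  letI : Module (SkewGroupAlgebra G) i.rep.V := Module.compHom i.rep.V (inflate i.rep.ρ)
  ModuleCat.of he.basicAlgebra (cornerSubgroup (∑ j, e j) i.rep.V)

/-! ### The embedding of `GL(m, ℂ)` into `SL(m + 1, ℂ)` -/

/-- The homomorphism `g ↦ diag(g, det(g)⁻¹)` from `GL(m, ℂ)` to `SL(m + 1, ℂ)`. -/
def embedSL (m : ℕ) : GL (Fin m) ℂ →* SL(m + 1, ℂ) where
  toFun g := ⟨Matrix.reindex finSumFinEquiv finSumFinEquiv
      (Matrix.fromBlocks g.val 0 0 (Matrix.of fun _ _ : Fin 1 => g.val.det⁻¹)), by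
    have : g.val.det ≠ 0 := g.det_ne_zero
    simp [Matrix.det_fromBlocks_zero₂₁, this]⟩
  map_one' := by
    apply Subtype.ext
    have : (Matrix.of fun _ _ : Fin 1 => (1 : ℂ)) = 1 := by ext i j; fin_cases i; fin_cases j; simp
    simp [this]
  map_mul' g h := by
    apply Subtype.ext
    have : (Matrix.of fun _ _ : Fin 1 => (h.val.det⁻¹ * g.val.det⁻¹ : ℂ)) =
        (Matrix.of fun _ _ : Fin 1 => g.val.det⁻¹) * (Matrix.of fun _ _ : Fin 1 => h.val.det⁻¹) := by
      ext i j; simp [Matrix.mul_apply, mul_comm]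
    change Matrix.reindex finSumFinEquiv finSumFinEquiv (Matrix.fromBlocks (g.val * h.val) 0 0
        (Matrix.of fun _ _ : Fin 1 => (g.val * h.val).det⁻¹)) =
      Matrix.reindex finSumFinEquiv finSumFinEquiv
          (Matrix.fromBlocks g.val 0 0 (Matrix.of fun _ _ : Fin 1 => g.val.det⁻¹)) *
        Matrix.reindex finSumFinEquiv finSumFinEquiv
          (Matrix.fromBlocks h.val 0 0 (Matrix.of fun _ _ : Fin 1 => h.val.det⁻¹))
    simp [Matrix.det_mul, this, Matrix.fromBlocks_multiply]

theorem embedSL_injective (m : ℕ) : Function.Injective (embedSL m) := by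
  intro g h hgh
  have h1 : Matrix.fromBlocks g.val 0 0 (Matrix.of fun _ _ : Fin 1 => g.val.det⁻¹) =
      Matrix.fromBlocks h.val 0 0 (Matrix.of fun _ _ : Fin 1 => h.val.det⁻¹) :=
    (Matrix.reindex finSumFinEquiv finSumFinEquiv).injective (congrArg Subtype.val hgh)
  exact Units.ext (Matrix.fromBlocks_inj.mp h1).1

/-- The image `G ⊂ SL(m + 1, ℂ)` of `G' ⊂ GL(m, ℂ)`, regarded as a subgroup of `GL(m + 1, ℂ)`. -/
def embeddedImage {m : ℕ} (G' : Subgroup (GL (Fin m) ℂ)) : Subgroup (GL (Fin (m + 1)) ℂ) :=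
  (G'.map (embedSL m)).map Matrix.SpecialLinearGroup.toGL

/-- The isomorphism from `G'` onto its image `G`. -/
def embeddedImageEquiv {m : ℕ} (G' : Subgroup (GL (Fin m) ℂ)) : G' ≃* embeddedImage G' :=
  (G'.equivMapOfInjective (embedSL m) (embedSL_injective m)).trans
    ((G'.map (embedSL m)).equivMapOfInjective Matrix.SpecialLinearGroup.toGL
      Matrix.SpecialLinearGroup.toGL_injective)

instance {m : ℕ} (G' : Subgroup (GL (Fin m) ℂ)) [Finite G'] : Finite (embeddedImage G') :=
  Finite.of_equiv G' (embeddedImageEquiv G').toEquiv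

end

/-! Write V' = ℂᵐ, A = ⋀V' * G', and let σ be tensoring with the determinant character of G'. The
proof shows that σ is the Nakayama permutation and that det⁻¹ accounts for exactly the extra arrows.

Arrows. Pulled back to G', the representation ℂ^(m+1) of G is V' ⊕ det⁻¹, so ℂ^(m+1) ⊗ Sᵢ ≅ (V' ⊗
Sᵢ) ⊕ (det⁻¹ ⊗ Sᵢ). By Schur's lemma multiplicities are dimensions of Hom spaces
(`irrMultiplicity_eq_finrank`), which add over the two summands. The second summand contributes one
arrow from i to j exactly when Sᵢ ≅ det ⊗ Sⱼ, that is, i = σ j (`irrMultiplicity_embeddedImage`).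

Socles. The A-module P = ⋀V' ⊗ Sᵢ is a direct summand of a free module, by averaging over G'
(`fromFree_averaging`). Since V' generates a nilpotent ideal, the kernel of P → Sᵢ is superfluous
(`eq_top_of_forall_exists_sub_mem_ker`), so P is the projective cover of Sᵢ. Multiplying by vectors
moves any nonzero element of P into the top degree ⋀ᵐV' ⊗ Sᵢ ≅ det ⊗ Sᵢ (`smul_topElement`), which
is simple. Hence the top degree lies in every nonzero submodule (`InducedModule.range_ofTop_le`) and
is the socle.

Passage to eAe. A submodule X of eM is recovered from the A-submodule AX as AX ∩ eM
(`mem_of_mem_cornerSpan`), so simplicity, superfluous kernels and essential simple submodules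
survive M ↦ eM. Projectivity of eP and eSᵢ ≠ 0 hold because P is indecomposable, hence isomorphic to
some Aeₖ. Uniqueness of σ follows since projective covers are unique and eSᵢ ≅ eSⱼ forces i = j
(`eq_of_vertexSimple_equiv`). -/

noncomputable section

/-! ### Multiplicities as dimensions of spaces of intertwining maps -/

section Intertwining

variable {G V V' W W' : Type*} [Group G] [AddCommGroup V] [Module ℂ V] [AddCommGroup V']
  [Module ℂ V'] [AddCommGroup W] [Module ℂ W] [AddCommGroup W'] [Module ℂ W']

/-- Spaces of intertwining maps between isomorphic representations are isomorphic. -/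
def Representation.Equiv.intertwiningCongr {ρ : Representation ℂ G V} {ρ' : Representation ℂ G V'}
    {τ : Representation ℂ G W} {τ' : Representation ℂ G W'} (a : ρ.Equiv ρ') (b : τ.Equiv τ') :
    Representation.IntertwiningMap ρ τ ≃ₗ[ℂ] Representation.IntertwiningMap ρ' τ' where
  toFun f := (b.toIntertwiningMap.comp f).comp a.symm.toIntertwiningMap
  invFun f := (b.symm.toIntertwiningMap.comp f).comp a.toIntertwiningMap
  map_add' f g := by ext; simp
  map_smul' c f := by ext; simp
  left_inv f := by ext; simp
  right_inv f := by ext; simp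

/-- Intertwining maps out of a product of two representations. -/
def Representation.IntertwiningMap.coprodEquiv (ρ : Representation ℂ G V)
    (ρ' : Representation ℂ G V') (τ : Representation ℂ G W) :
    Representation.IntertwiningMap (ρ.prod ρ') τ ≃ₗ[ℂ]
      Representation.IntertwiningMap ρ τ × Representation.IntertwiningMap ρ' τ where
  toFun f := (f.comp (.inl ℂ ρ ρ'), f.comp (.inr ℂ ρ ρ'))
  invFun f := f.1.comp (.fst ℂ ρ ρ') + f.2.comp (.snd ℂ ρ ρ')
  map_add' f g := by ext <;> simp
  map_smul' c f := by ext <;> simp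
  left_inv f := by
    refine Representation.IntertwiningMap.ext (LinearMap.ext fun v => ?_)
    change f (v.1, 0) + f (0, v.2) = f v
    rw [← map_add]
    simp
  right_inv f := by
    refine Prod.ext ?_ ?_ <;> refine Representation.IntertwiningMap.ext (LinearMap.ext fun v => ?_)
    · change f.1 v + f.2 0 = f.1 v
      simp
    · change f.1 0 + f.2 v = f.2 v
      simp

/-- Intertwining maps are unchanged by pulling back along an isomorphism of groups. -/
def Representation.IntertwiningMap.compEquiv {H : Type*} [Group H] (φ : G ≃* H)
    (ρ : Representation ℂ H V) (τ : Representation ℂ H W) :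
    Representation.IntertwiningMap ρ τ ≃ₗ[ℂ]
      Representation.IntertwiningMap (ρ.comp φ.toMonoidHom) (τ.comp φ.toMonoidHom) where
  toFun f := ⟨f.toLinearMap, fun g => f.isIntertwining' (φ g)⟩
  invFun f := ⟨f.toLinearMap, fun h => by simpa using f.isIntertwining' (φ.symm h)⟩
  map_add' _ _ := rfl
  map_smul' _ _ := rfl
  left_inv f := rfl
  right_inv f := rfl

/-- The inclusion of a summand in a direct sum of representations. -/
def Representation.directSumInclusion {J : Type*} [DecidableEq J] {U : J → Type*}
    [∀ p, AddCommGroup (U p)] [∀ p, Module ℂ (U p)] (τ : ∀ p, Representation ℂ G (U p)) (p : J) :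
    Representation.IntertwiningMap (τ p) (Representation.directSum τ) :=
  ⟨DirectSum.lof ℂ J U p, fun g => by ext v : 1; simp [Representation.directSum]⟩

/-- The intertwining map out of a direct sum with given components. -/
def Representation.directSumDesc {J : Type*} [DecidableEq J] {U : J → Type*}
    [∀ p, AddCommGroup (U p)] [∀ p, Module ℂ (U p)] {τ : ∀ p, Representation ℂ G (U p)}
    {ρ : Representation ℂ G V} (c : ∀ p, Representation.IntertwiningMap (τ p) ρ) :
    Representation.IntertwiningMap (Representation.directSum τ) ρ :=
  ⟨DirectSum.toModule ℂ J V fun p => (c p).toLinearMap, fun g => by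
    refine DirectSum.linearMap_ext _ fun p => LinearMap.ext fun v => ?_
    simpa [Representation.directSum] using (c p).isIntertwining _ _ g v⟩

end Intertwining

/-! ### Schur's lemma and isotypic multiplicities. -/

section Multiplicity

variable {G : Type} [Group G]

theorem IrrRep.subsingleton_intertwiningMap {S T : IrrRep G} (h : ¬ S ≈ T) :
    Subsingleton (Representation.IntertwiningMap S.ρ T.ρ) := by
  have : IsEmpty (S.ρ.Equiv T.ρ) := not_nonempty_iff.mp h
  infer_instance

theorem Irr.rep_equiv_iff {i j : Irr G} : i.rep ≈ j.rep ↔ i = j :=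
  Quotient.out_equiv_out

/-- The isomorphism class of an irreducible representation. -/
def IrrRep.cls (S : IrrRep G) : Irr G := Quotient.mk _ S

theorem IrrRep.cls_eq_iff {S T : IrrRep G} : S.cls = T.cls ↔ Nonempty (S.ρ.Equiv T.ρ) :=
  Quotient.eq (r := IrrRep.isoSetoid G)

theorem Irr.cls_rep (i : Irr G) : i.rep.cls = i := Quotient.out_eq i

theorem IrrRep.finrank_intertwiningMap [DecidableEq (Irr G)] (S T : IrrRep G) :
    Module.finrank ℂ (Representation.IntertwiningMap S.ρ T.ρ) =
      if S.cls = T.cls then 1 else 0 := by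
  split_ifs with h
  · obtain ⟨a⟩ := IrrRep.cls_eq_iff.mp h
    rw [((Representation.Equiv.refl S.ρ).intertwiningCongr a.symm).finrank_eq]
    exact Representation.IsIrreducible.finrank_intertwiningMap_self _
  · have := IrrRep.subsingleton_intertwiningMap (mt IrrRep.cls_eq_iff.mpr h)
    exact Module.finrank_zero_of_subsingleton

variable {W : Type} [AddCommGroup W] [Module ℂ W]

open Classical in
/-- Restriction of intertwining maps `⨁ⱼ a j • Sⱼ → Sⱼ` to the summands isomorphic to `Sⱼ`. -/
def restrictIsotypic (a : Irr G → ℕ) (j : Irr G) :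
    Representation.IntertwiningMap
        (Representation.directSum fun p : (Σ j : Irr G, Fin (a j)) => p.1.rep.ρ) j.rep.ρ →ₗ[ℂ]
      (Fin (a j) → Representation.IntertwiningMap j.rep.ρ j.rep.ρ) where
  toFun f k := f.comp (Representation.directSumInclusion
    (fun p : (Σ j : Irr G, Fin (a j)) => p.1.rep.ρ) ⟨j, k⟩)
  map_add' _ _ := rfl
  map_smul' _ _ := rfl

/-- By Schur's lemma a map to Sⱼ vanishes on every summand of another class, so it is determined by
its components on the copies of Sⱼ, and these can be prescribed freely. -/
theorem restrictIsotypic_bijective (a : Irr G → ℕ) (j : Irr G) :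
    Function.Bijective (restrictIsotypic a j) := by
  classical
  constructor
  · rw [← LinearMap.ker_eq_bot, LinearMap.ker_eq_bot']
    intro f hf
    have key : ∀ p, f.comp (Representation.directSumInclusion
        (fun p : (Σ j : Irr G, Fin (a j)) => p.1.rep.ρ) p) = 0 := by
      rintro ⟨i, k⟩
      by_cases h : i = j
      · subst h
        have := congrFun hf k
        exact this
      · have := IrrRep.subsingleton_intertwiningMap (mt Irr.rep_equiv_iff.mp h)
        exact Subsingleton.elim _ _
    apply Representation.IntertwiningMap.ext
    refine DirectSum.linearMap_ext _ fun p => ?_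
    exact congrArg Representation.IntertwiningMap.toLinearMap (key p)
  · intro F
    let c (p : Σ j : Irr G, Fin (a j)) : Representation.IntertwiningMap p.1.rep.ρ j.rep.ρ :=
      if h : p.1 = j then by obtain ⟨i, k⟩ := p; subst h; exact F k else 0
    refine ⟨Representation.directSumDesc c, funext fun k =>
      Representation.IntertwiningMap.ext (LinearMap.ext fun v => ?_)⟩
    change DirectSum.toModule ℂ _ _ (fun p => (c p).toLinearMap) (DirectSum.lof ℂ _ _ ⟨j, k⟩ v) = _
    rw [DirectSum.toModule_lof]
    simp [c]

/-- Each copy of Sⱼ contributes End(Sⱼ), which is one-dimensional over ℂ. In particular the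
multiplicities do not depend on the chosen decomposition. -/
theorem IsDecomposition.finrank_intertwiningMap {ρ : Representation ℂ G W} {a : Irr G → ℕ}
    (h : IsDecomposition ρ a) (j : Irr G) :
    Module.finrank ℂ (Representation.IntertwiningMap ρ j.rep.ρ) = a j := by
  obtain ⟨E⟩ := h
  rw [((E.intertwiningCongr (.refl j.rep.ρ)).trans
    (LinearEquiv.ofBijective _ (restrictIsotypic_bijective a j))).finrank_eq]
  rw [Module.finrank_pi_fintype]
  simp

theorem irrMultiplicity_eq_finrank [Finite G] [FiniteDimensional ℂ W] (ρ : Representation ℂ G W)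
    (j : Irr G) :
    irrMultiplicity ρ j = Module.finrank ℂ (Representation.IntertwiningMap ρ j.rep.ρ) :=
  ((exists_isDecomposition ρ).choose_spec.finrank_intertwiningMap j).symm

/-- Multiplicities in isomorphic representations of isomorphic groups agree. -/
theorem finrank_intertwiningMap_pullback {G H W : Type} [Group G] [Group H] [AddCommGroup W]
    [Module ℂ W] (φ : G ≃* H) (ρ : Representation ℂ H W) (j : Irr H) :
    Module.finrank ℂ (Representation.IntertwiningMap ρ j.rep.ρ) =
      Module.finrank ℂ (Representation.IntertwiningMap (ρ.comp φ.toMonoidHom)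
        (Irr.pullback φ j).rep.ρ) := by
  -- Representatives are chosen separately for each group, so pulling back a representative gives
  -- the representative of the pulled back class only up to isomorphism.
  have h : (j.rep.pullback φ).cls = (Irr.pullback φ j).rep.cls := by
    rw [Irr.cls_rep]
    conv_rhs => rw [← Irr.cls_rep j]
    rfl
  obtain ⟨a⟩ := IrrRep.cls_eq_iff.mp h
  exact ((Representation.IntertwiningMap.compEquiv φ ρ j.rep.ρ).trans
    ((Representation.Equiv.refl _).intertwiningCongr a)).finrank_eq

end Multiplicity

/-! ### Twisting by a character -/

section Twist

variable {G : Type} [Group G]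

/-- The tensor product of a representation with a one-dimensional representation. -/
def Representation.twist {V : Type*} [AddCommGroup V] [Module ℂ V] (χ : G →* ℂˣ)
    (ρ : Representation ℂ G V) : Representation ℂ G V where
  toFun g := (χ g : ℂ) • ρ g
  map_one' := by simp
  map_mul' g h := by
    ext v
    simp [smul_smul, mul_comm]

theorem Representation.twist_apply {V : Type*} [AddCommGroup V] [Module ℂ V] (χ : G →* ℂˣ)
    (ρ : Representation ℂ G V) (g : G) : ρ.twist χ g = (χ g : ℂ) • ρ g := rfl

/-- Subrepresentations are unchanged by twisting. -/
def Subrepresentation.twistIso {V : Type*} [AddCommGroup V] [Module ℂ V] (χ : G →* ℂˣ)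
    (ρ : Representation ℂ G V) : Subrepresentation ρ ≃o Subrepresentation (ρ.twist χ) where
  toFun U := ⟨U.toSubmodule, fun g _ hv =>
    U.toSubmodule.smul_mem (χ g : ℂ) (U.apply_mem_toSubmodule g hv)⟩
  invFun U := ⟨U.toSubmodule, fun g v hv => by
    have := U.toSubmodule.smul_mem ((χ g)⁻¹ : ℂˣ).val (U.apply_mem_toSubmodule g hv)
    simpa [Representation.twist_apply, smul_smul] using this⟩
  left_inv _ := rfl
  right_inv _ := rfl
  map_rel_iff' := Iff.rfl

/-- The twist of an irreducible representation. -/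
def IrrRep.twist (χ : G →* ℂˣ) (S : IrrRep G) : IrrRep G where
  V := S.V
  ρ := S.ρ.twist χ
  irreducible := (Subrepresentation.twistIso χ S.ρ).symm.isSimpleOrder_iff.mpr S.irreducible

/-- Twisting respects isomorphisms. -/
def Representation.Equiv.twist {V W : Type*} [AddCommGroup V] [Module ℂ V] [AddCommGroup W]
    [Module ℂ W] {ρ : Representation ℂ G V} {τ : Representation ℂ G W} (χ : G →* ℂˣ)
    (a : ρ.Equiv τ) : (ρ.twist χ).Equiv (τ.twist χ) :=
  .mk a.toLinearEquiv fun g => LinearMap.ext fun v => by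
    have := LinearMap.congr_fun (a.isIntertwining' g) v
    have h : a (ρ g v) = τ g (a v) := this
    simp [Representation.twist_apply, h]

theorem Representation.twist_twist_of_mul_eq_one {V : Type*} [AddCommGroup V] [Module ℂ V]
    {χ ψ : G →* ℂˣ} (h : ψ * χ = 1) (ρ : Representation ℂ G V) : (ρ.twist χ).twist ψ = ρ := by
  ext g v
  have : (ψ g : ℂ) * (χ g : ℂ) = 1 := by
    rw [← Units.val_mul, ← MonoidHom.mul_apply, h]; rfl
  simp [Representation.twist_apply, smul_smul, this]

/-- The action of a character on isomorphism classes of irreducible representations. -/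
def Irr.twist (χ : G →* ℂˣ) : Equiv.Perm (Irr G) where
  toFun := Quotient.map (IrrRep.twist χ) fun _ _ ⟨a⟩ => ⟨a.twist χ⟩
  invFun := Quotient.map (IrrRep.twist χ⁻¹) fun _ _ ⟨a⟩ => ⟨a.twist χ⁻¹⟩
  left_inv := by
    rintro ⟨S⟩
    refine IrrRep.cls_eq_iff.mpr ⟨?_⟩
    change ((S.ρ.twist χ).twist χ⁻¹).Equiv S.ρ
    rw [Representation.twist_twist_of_mul_eq_one (inv_mul_cancel χ)]
    exact .refl _
  right_inv := by
    rintro ⟨S⟩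
    refine IrrRep.cls_eq_iff.mpr ⟨?_⟩
    change ((S.ρ.twist χ⁻¹).twist χ).Equiv S.ρ
    rw [Representation.twist_twist_of_mul_eq_one (mul_inv_cancel χ)]
    exact .refl _

theorem IrrRep.cls_twist (χ : G →* ℂˣ) (S : IrrRep G) : (S.twist χ).cls = Irr.twist χ S.cls :=
  rfl

theorem Irr.cls_twist_rep (χ : G →* ℂˣ) (i : Irr G) : (i.rep.twist χ).cls = Irr.twist χ i := by
  rw [IrrRep.cls_twist, Irr.cls_rep]

end Twist

/-! ### The McKay quiver of the image of the embedding -/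

section Embedding

variable {m : ℕ} (G' : Subgroup (GL (Fin m) ℂ))

/-- The determinant character of a subgroup of `GL(m, ℂ)`. -/
def detChar : G' →* ℂˣ := Matrix.GeneralLinearGroup.det.comp G'.subtype

/-- The splitting of `ℂ^(m+1)` into the first `m` coordinates and the last one. -/
def splitLast (m : ℕ) : (Fin (m + 1) → ℂ) ≃ₗ[ℂ] (Fin m → ℂ) × ℂ :=
  (LinearEquiv.funCongrLeft ℂ ℂ finSumFinEquiv).trans
    ((LinearEquiv.sumArrowLequivProdArrow (Fin m) (Fin 1) ℂ ℂ).trans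
      ((LinearEquiv.refl ℂ _).prodCongr (LinearEquiv.funUnique (Fin 1) ℂ ℂ)))

theorem splitLast_embeddedImageEquiv (g : G') (x : Fin (m + 1) → ℂ) :
    splitLast m (naturalRep _ (embeddedImageEquiv G' g) x) =
      (naturalRep G' g (splitLast m x).1, ((detChar G')⁻¹ g : ℂ) * (splitLast m x).2) := by
  change splitLast m ((Matrix.reindex finSumFinEquiv finSumFinEquiv
      (Matrix.fromBlocks g.1.val 0 0 (Matrix.of fun _ _ : Fin 1 => g.1.val.det⁻¹))).mulVec x) = _
  rw [Matrix.reindex_apply, Matrix.submatrix_mulVec_equiv]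
  simp [splitLast, LinearEquiv.sumArrowLequivProdArrow]
  refine ⟨funext fun k => ?_, ?_⟩
  · simp [Equiv.sumArrowEquivProdArrow, LinearMap.funLeft, Matrix.fromBlocks_mulVec, naturalRep]
  · simp [detChar, Matrix.mulVec, dotProduct]

/-- The decomposition of the natural representation of the image of `g ↦ diag(g, det(g)⁻¹)`,
tensored with a representation. -/
def embeddedTensorEquiv {W : Type} [AddCommGroup W] [Module ℂ W]
    (τ : Representation ℂ (embeddedImage G') W) (τ' : Representation ℂ G' W)
    (h : ∀ g, τ (embeddedImageEquiv G' g) = τ' g) :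
    Representation.Equiv (((naturalRep (embeddedImage G')).tprod τ).comp
        (embeddedImageEquiv G').toMonoidHom : Representation ℂ G' _)
      (((naturalRep G').tprod τ').prod (τ'.twist (detChar G')⁻¹)) :=
  .mk ((TensorProduct.congr (splitLast m) (LinearEquiv.refl ℂ W)).trans
      ((TensorProduct.prodLeft ℂ ℂ (Fin m → ℂ) ℂ W).trans
        ((LinearEquiv.refl ℂ _).prodCongr (TensorProduct.lid ℂ W)))) fun g => by
    refine TensorProduct.ext' fun x w => ?_
    have h1 := splitLast_embeddedImageEquiv G' g x
    generalize hx : splitLast m x = y at h1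
    obtain ⟨y₁, y₂⟩ := y
    simp [h1, h, hx, Representation.twist_apply, mul_smul]
    exact smul_comm _ _ _

/-- Tensoring on the left respects isomorphisms. -/
def Representation.Equiv.tprodLeft {G V W W' : Type*} [Group G] [AddCommGroup V] [Module ℂ V]
    [AddCommGroup W] [Module ℂ W] [AddCommGroup W'] [Module ℂ W'] (ρ : Representation ℂ G V)
    {τ : Representation ℂ G W} {τ' : Representation ℂ G W'} (a : τ.Equiv τ') :
    (ρ.tprod τ).Equiv (ρ.tprod τ') :=
  .mk (TensorProduct.congr (LinearEquiv.refl ℂ V) a.toLinearEquiv) fun g =>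
    TensorProduct.ext' fun v w => by
      have h : a (τ g w) = τ' g (a w) := LinearMap.congr_fun (a.isIntertwining' g) w
      simp [h]

instance {G V W : Type*} [Group G] [AddCommGroup V] [Module ℂ V] [AddCommGroup W] [Module ℂ W]
    [FiniteDimensional ℂ V] [FiniteDimensional ℂ W] (ρ : Representation ℂ G V)
    (τ : Representation ℂ G W) : FiniteDimensional ℂ (Representation.IntertwiningMap ρ τ) :=
  Module.Finite.of_injective
    ({ toFun := fun f => f.toLinearMap
       map_add' := fun _ _ => rfl
       map_smul' := fun _ _ => rfl } :
      Representation.IntertwiningMap ρ τ →ₗ[ℂ] V →ₗ[ℂ] W)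
    (Representation.IntertwiningMap.toLinearMap_injective ρ τ)

/-- Hom out of (V' ⊗ Sᵢ) ⊕ (det⁻¹ ⊗ Sᵢ) is a product; the second factor has dimension 1 or 0 by
Schur's lemma. -/
theorem irrMultiplicity_embeddedImage [Finite G'] [DecidableEq (Irr G')]
    (i j : Irr (embeddedImage G')) :
    irrMultiplicity ((naturalRep (embeddedImage G')).tprod i.rep.ρ) j =
      irrMultiplicity ((naturalRep G').tprod (Irr.pullback (embeddedImageEquiv G') i).rep.ρ)
          (Irr.pullback (embeddedImageEquiv G') j) +
        if Irr.twist (detChar G') (Irr.pullback (embeddedImageEquiv G') j) =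
          Irr.pullback (embeddedImageEquiv G') i then 1 else 0 := by
  set φ := embeddedImageEquiv G'
  have h : (i.rep.pullback φ).cls = (Irr.pullback φ i).rep.cls := by
    rw [Irr.cls_rep]
    conv_rhs => rw [← Irr.cls_rep i]
    rfl
  obtain ⟨a⟩ := IrrRep.cls_eq_iff.mp h
  rw [irrMultiplicity_eq_finrank, irrMultiplicity_eq_finrank, finrank_intertwiningMap_pullback φ,
    ((embeddedTensorEquiv G' i.rep.ρ (i.rep.pullback φ).ρ fun _ => rfl).intertwiningCongr
      (.refl _)).finrank_eq,
    (Representation.IntertwiningMap.coprodEquiv _ _ _).finrank_eq]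
  have : FiniteDimensional ℂ (i.rep.pullback φ).V := (i.rep.pullback φ).finiteDimensional
  rw [Module.finrank_prod]
  congr 1
  · exact ((Representation.Equiv.tprodLeft _ a).intertwiningCongr (.refl _)).finrank_eq
  · have := IrrRep.finrank_intertwiningMap ((i.rep.pullback φ).twist (detChar G')⁻¹)
      (Irr.pullback φ j).rep
    refine this.trans (if_congr ?_ rfl rfl)
    rw [IrrRep.cls_twist, h, Irr.cls_rep, Irr.cls_rep]
    -- Twisting by det⁻¹ is by definition the inverse permutation, which turns det⁻¹ ⊗ Sᵢ ≅ Sⱼ into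
    -- Sᵢ ≅ det ⊗ Sⱼ and fixes the direction of the added arrow.
    exact (Irr.twist (detChar G')).symm_apply_eq.trans eq_comm

theorem exists_quiverIso_addArrows_twist [Finite G'] :
    ∃ F : QuiverIso (mckayQuiver (embeddedImage G'))
      ((mckayQuiver G').addArrows (Irr.twist (detChar G'))),
      F.onVertices = Irr.pullback (embeddedImageEquiv G') := by
  classical
  refine ⟨⟨Irr.pullback (embeddedImageEquiv G'), fun i j => ?_⟩, rfl⟩
  refine (finCongr (irrMultiplicity_embeddedImage G' i j)).trans
    (finSumFinEquiv.symm.trans ((Equiv.refl _).sumCongr ?_))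
  set j' := Irr.pullback (embeddedImageEquiv G') j
  set i' := Irr.pullback (embeddedImageEquiv G') i
  -- The only possible index of an added arrow ending at j' is j' itself, so the set of added arrows
  -- from i' to j' is a singleton or empty.
  by_cases h : Irr.twist (detChar G') j' = i'
  · rw [if_pos h]
    have : Unique {k : Irr G' // Irr.twist (detChar G') k = i' ∧ k = j'} :=
      { default := ⟨j', h, rfl⟩
        uniq := fun k => Subtype.ext k.2.2 }
    exact Equiv.ofUnique _ _
  · rw [if_neg h]
    have : IsEmpty {k : Irr G' // Irr.twist (detChar G') k = i' ∧ k = j'} :=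
      ⟨fun k => h (k.2.2 ▸ k.2.1)⟩
    exact Equiv.equivOfIsEmpty _ _

end Embedding

/-! ### The exterior algebra of `ℂᵐ` and its socle -/

section Exterior

variable {m : ℕ}

local notation "Λ" => ExteriorAlgebra ℂ (Fin m → ℂ)

/-- Contraction of the exterior algebra by a coordinate function. -/
def contractCoord (k : Fin m) : Λ →ₗ[ℂ] Λ :=
  CliffordAlgebra.contractLeft (LinearMap.proj k)

theorem contractCoord_ι_mul (k : Fin m) (v : Fin m → ℂ) (x : Λ) :
    contractCoord k (ExteriorAlgebra.ι ℂ v * x) =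
      v k • x - ExteriorAlgebra.ι ℂ v * contractCoord k x :=
  CliffordAlgebra.contractLeft_ι_mul _ _ _

variable {S : Type*} [AddCommGroup S] [Module ℂ S]

/-- Contraction is an antiderivation. If `ι v` kills x, this rule expresses `v k • x` as a multiple
of `ι v`. -/
theorem rTensor_contractCoord_ι_smul (k : Fin m) (v : Fin m → ℂ) (x : Λ ⊗[ℂ] S) :
    (contractCoord k).rTensor S (ExteriorAlgebra.ι ℂ v • x) =
      v k • x - ExteriorAlgebra.ι ℂ v • (contractCoord k).rTensor S x := by
  induction x with
  | zero => simp
  | tmul a s =>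
    simp [TensorProduct.smul_tmul', contractCoord_ι_mul, TensorProduct.sub_tmul]
  | add x y hx hy =>
    simp only [smul_add, map_add, hx, hy]
    abel

/-- The product of the standard basis vectors with indices in a list. -/
def basisProd (l : List (Fin m)) : Λ :=
  (l.map fun k => ExteriorAlgebra.ι ℂ (Pi.single k 1 : Fin m → ℂ)).prod

/-- Contraction by the k-th coordinate anticommutes with multiplication by every other basis vector,
so it passes through the product up to sign. -/
theorem exists_rTensor_contractCoord_basisProd_smul {k : Fin m} {l : List (Fin m)} (hk : k ∉ l)
    (y : Λ ⊗[ℂ] S) :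
    ∃ z, (contractCoord k).rTensor S (basisProd l • y) = basisProd l • z := by
  induction l with
  | nil => exact ⟨_, by simp [basisProd]; rfl⟩
  | cons i l ih =>
    obtain ⟨z, hz⟩ := ih (fun h => hk (List.mem_cons_of_mem _ h))
    have hi : k ≠ i := fun h => hk (h ▸ List.mem_cons_self)
    refine ⟨-z, ?_⟩
    have : basisProd (i :: l) = ExteriorAlgebra.ι ℂ (Pi.single i 1 : Fin m → ℂ) * basisProd l := by
      simp [basisProd]
    rw [this, mul_smul, rTensor_contractCoord_ι_smul, hz]
    simp [hi, mul_smul]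

/-- If every vector kills x, the antiderivation rule gives x = eₖ · (contraction of x by k). When x
is already divisible by a product not involving eₖ, so is its contraction, and the factors
accumulate. -/
theorem exists_eq_basisProd_smul {x : Λ ⊗[ℂ] S}
    (hx : ∀ v : Fin m → ℂ, ExteriorAlgebra.ι ℂ v • x = 0) {l : List (Fin m)} (hl : l.Nodup) :
    ∃ y, x = basisProd l • y := by
  induction l with
  | nil => exact ⟨x, by simp [basisProd]⟩
  | cons k l ih =>
    obtain ⟨y, hy⟩ := ih hl.of_cons
    obtain ⟨z, hz⟩ := exists_rTensor_contractCoord_basisProd_smul (List.nodup_cons.mp hl).1 y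
    refine ⟨z, ?_⟩
    have h := rTensor_contractCoord_ι_smul k (Pi.single k 1) x
    rw [hx, map_zero, Pi.single_eq_same, one_smul, eq_comm, sub_eq_zero, hy, hz, ← hy] at h
    rw [h]
    simp [basisProd, mul_smul]

/-- More than m vectors in ℂᵐ are linearly dependent, and the product is alternating. This is the
nilpotency behind both the superfluous kernel and the socle. -/
theorem prod_map_ι_eq_zero {l : List (Fin m → ℂ)} (hl : m < l.length) :
    (l.map (ExteriorAlgebra.ι ℂ)).prod = 0 := by
  have h : ExteriorAlgebra.ιMulti ℂ l.length l.get = 0 := by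
    refine AlternatingMap.map_linearDependent _ _ fun hli => ?_
    have := hli.fintype_card_le_finrank
    simp at this
    omega
  rw [ExteriorAlgebra.ιMulti_apply] at h
  rw [← h]
  congr 1
  refine List.ext_get (by simp) fun i h1 h2 => by simp

/-- The generator of the top exterior power. -/
def topElement (m : ℕ) : ExteriorAlgebra ℂ (Fin m → ℂ) :=
  basisProd (List.finRange m)

theorem basisProd_eq_prod_map_ι (l : List (Fin m)) :
    basisProd l = ((l.map fun k => (Pi.single k 1 : Fin m → ℂ)).map (ExteriorAlgebra.ι ℂ)).prod := by
  simp [basisProd, Function.comp_def]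

theorem topElement_eq_ιMulti :
    topElement m = ExteriorAlgebra.ιMulti ℂ m fun k => (Pi.single k 1 : Fin m → ℂ) := by
  rw [ExteriorAlgebra.ιMulti_apply, topElement, basisProd, List.ofFn_eq_map]

theorem topElement_mul_ι (v : Fin m → ℂ) : topElement m * ExteriorAlgebra.ι ℂ v = 0 := by
  have := prod_map_ι_eq_zero
    (l := ((List.finRange m).map fun k => (Pi.single k 1 : Fin m → ℂ)) ++ [v]) (by simp)
  rw [List.map_append, List.prod_append, ← basisProd_eq_prod_map_ι] at this
  simpa [topElement] using this

theorem ι_mul_topElement (v : Fin m → ℂ) : ExteriorAlgebra.ι ℂ v * topElement m = 0 := by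
  have := prod_map_ι_eq_zero
    (l := v :: ((List.finRange m).map fun k => (Pi.single k 1 : Fin m → ℂ))) (by simp)
  rw [List.map_cons, List.prod_cons, ← basisProd_eq_prod_map_ι] at this
  exact this

/-- Vectors kill the top degree, so multiplication there factors through the augmentation. -/
theorem topElement_mul (x : Λ) :
    topElement m * x = ExteriorAlgebra.algebraMapInv x • topElement m := by
  induction x using ExteriorAlgebra.induction with
  | algebraMap r =>
    rw [← Algebra.commutes, ← Algebra.smul_def]
    congr 1
    exact (ExteriorAlgebra.algebraMap_leftInverse _ r).symm
  | ι v => simp [topElement_mul_ι, ExteriorAlgebra.algebraMapInv]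
  | mul a b ha hb => rw [← mul_assoc, ha, smul_mul_assoc, hb, map_mul, smul_smul]
  | add a b ha hb => rw [mul_add, ha, hb, map_add, add_smul]

/-- The augmentation `⋀V ⊗ S → S`. -/
def augmentation (m : ℕ) (S : Type*) [AddCommGroup S] [Module ℂ S] :
    ExteriorAlgebra ℂ (Fin m → ℂ) ⊗[ℂ] S →ₗ[ℂ] S :=
  (TensorProduct.lid ℂ S).toLinearMap ∘ₗ
    (ExteriorAlgebra.algebraMapInv (R := ℂ) (M := Fin m → ℂ)).toLinearMap.rTensor S

@[simp]
theorem augmentation_tmul (x : Λ) (s : S) :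
    augmentation m S (x ⊗ₜ s) = ExteriorAlgebra.algebraMapInv x • s := by
  simp [augmentation]

theorem topElement_smul (y : Λ ⊗[ℂ] S) :
    topElement m • y = topElement m ⊗ₜ augmentation m S y := by
  induction y with
  | zero => simp
  | tmul a s =>
    rw [TensorProduct.smul_tmul', smul_eq_mul, topElement_mul, TensorProduct.smul_tmul,
      augmentation_tmul]
  | add x y hx hy => rw [smul_add, hx, hy, map_add, TensorProduct.tmul_add]

/-- An element of `⋀V ⊗ S` killed by `V` lies in the top degree. -/
theorem exists_eq_topElement_tmul {x : Λ ⊗[ℂ] S}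
    (hx : ∀ v : Fin m → ℂ, ExteriorAlgebra.ι ℂ v • x = 0) : ∃ s, x = topElement m ⊗ₜ s := by
  obtain ⟨y, hy⟩ := exists_eq_basisProd_smul hx (List.nodup_finRange m)
  exact ⟨_, hy.trans (topElement_smul y)⟩

/-- The coefficient of the top degree part. -/
def topCoeff (m : ℕ) : ExteriorAlgebra ℂ (Fin m → ℂ) →ₗ[ℂ] ℂ :=
  ExteriorAlgebra.liftAlternating (Pi.single m Matrix.detRowAlternating)

theorem topCoeff_ιMulti (v : Fin m → Fin m → ℂ) :
    topCoeff m (ExteriorAlgebra.ιMulti ℂ m v) = Matrix.det (Matrix.of v) := by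
  rw [topCoeff, ExteriorAlgebra.liftAlternating_apply_ιMulti, Pi.single_eq_same]
  rfl

theorem topCoeff_topElement : topCoeff m (topElement m) = 1 := by
  rw [topElement_eq_ιMulti, topCoeff_ιMulti]
  have : Matrix.of (fun k => (Pi.single k 1 : Fin m → ℂ)) = 1 := by
    ext i j
    simp [Matrix.one_apply, Pi.single_apply, eq_comm]
  rw [this, Matrix.det_one]

/-- The top coefficient functional provides a left inverse. -/
theorem topElement_tmul_injective :
    Function.Injective fun s : S => (topElement m ⊗ₜ s : Λ ⊗[ℂ] S) := by
  intro s t h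
  have := congrArg (fun x => TensorProduct.lid ℂ S ((topCoeff m).rTensor S x)) h
  simpa [topCoeff_topElement] using this

/-- The image of the top element is again a product of m vectors, hence killed by every vector,
hence a multiple of the top element; the top coefficient identifies the factor as the determinant.
This is the origin of the twist by det. -/
theorem smul_topElement (g : GL (Fin m) ℂ) : g • topElement m = g.val.det • topElement m := by
  have h : g • topElement m = ExteriorAlgebra.ιMulti ℂ m
      (fun k => g.val.mulVec (Pi.single k 1)) := by
    rw [topElement_eq_ιMulti]
    exact ExteriorAlgebra.map_apply_ιMulti _ _
  have hdet : topCoeff m (g • topElement m) = g.val.det := by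
    -- The vectors g eₖ are the columns of g but enter the determinant as rows.
    rw [h, topCoeff_ιMulti, ← Matrix.det_transpose]
    congr 1
    ext i j
    simp
  obtain ⟨c, hc⟩ := exists_eq_topElement_tmul (S := ℂ) (x := (g • topElement m) ⊗ₜ 1) fun v => by
    rw [TensorProduct.smul_tmul', smul_eq_mul, h, ExteriorAlgebra.ιMulti_apply]
    have := prod_map_ι_eq_zero (l := v :: List.ofFn fun k => g.val.mulVec (Pi.single k 1))
      (by simp)
    rw [List.map_cons, List.prod_cons, List.map_ofFn] at this
    rw [Function.comp_def] at this
    rw [this, TensorProduct.zero_tmul]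
  have hc' := congrArg (TensorProduct.rid ℂ _) hc
  simp only [TensorProduct.rid_tmul, one_smul] at hc'
  have h2 := congrArg (topCoeff m) hc'
  rw [hdet, map_smul, topCoeff_topElement, smul_eq_mul, mul_one] at h2
  rw [hc', h2]

/-- The augmentation ideal is generated by vectors as a right ideal; for products, ab − ε(a)ε(b) =
(a − ε(a))b + ε(a)(b − ε(b)). -/
theorem sub_algebraMapInv_mem_span (x : Λ) :
    x - algebraMap ℂ _ (ExteriorAlgebra.algebraMapInv x) ∈
      Submodule.span ℂ {z : Λ | ∃ v y, z = ExteriorAlgebra.ι ℂ v * y} := by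
  induction x using ExteriorAlgebra.induction with
  | algebraMap r =>
    rw [show ExteriorAlgebra.algebraMapInv (algebraMap ℂ Λ r) = r from
      ExteriorAlgebra.algebraMap_leftInverse _ r, sub_self]
    exact zero_mem _
  | ι v =>
    refine Submodule.subset_span ⟨v, 1, ?_⟩
    simp [ExteriorAlgebra.algebraMapInv]
  | mul a b ha hb =>
    set N := Submodule.span ℂ {z : Λ | ∃ v y, z = ExteriorAlgebra.ι ℂ v * y}
    have hN : ∀ z ∈ N, z * b ∈ N := fun z hz => by
      induction hz using Submodule.span_induction with
      | mem z hz =>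
        obtain ⟨v, y, rfl⟩ := hz
        exact Submodule.subset_span ⟨v, y * b, mul_assoc _ _ _⟩
      | zero => simp
      | add x y _ _ hx hy => rw [add_mul]; exact add_mem hx hy
      | smul c x _ hx => rw [smul_mul_assoc]; exact N.smul_mem c hx
    have := add_mem (hN _ ha) (N.smul_mem (ExteriorAlgebra.algebraMapInv a) hb)
    convert this using 1
    rw [Algebra.smul_def, map_mul, map_mul]
    noncomm_ring
  | add a b ha hb =>
    have := add_mem ha hb
    convert this using 1
    rw [map_add, map_add]
    abel

end Exterior

/-! ### Projective covers and socles -/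

section Covers

variable {R P P' M : Type*} [Ring R] [AddCommGroup P] [Module R P] [AddCommGroup P'] [Module R P']
  [AddCommGroup M] [Module R M]

/-- Projective covers are unique up to isomorphism. -/
theorem IsProjectiveCover.nonempty_equiv {π : P →ₗ[R] M} {π' : P' →ₗ[R] M}
    (h : IsProjectiveCover π) (h' : IsProjectiveCover π') : Nonempty (P ≃ₗ[R] P') := by
  have := h.projective
  have := h'.projective
  obtain ⟨f, hf⟩ := Module.projective_lifting_property π' π h'.surjective
  have hfx : ∀ x, π' (f x) = π x := LinearMap.congr_fun hf
  have hf_surj : Function.Surjective f := by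
    rw [← LinearMap.range_eq_top]
    refine h'.superfluous _ (eq_top_iff.mpr fun y _ => ?_)
    obtain ⟨x, hx⟩ := h.surjective (π' y)
    refine Submodule.mem_sup.mpr ⟨f x, ⟨x, rfl⟩, y - f x, ?_, by abel⟩
    simp [hfx, hx]
  -- The lift f splits because its target is projective. Its section s is injective, and surjective
  -- because its image together with the superfluous kernel of π is everything.
  obtain ⟨s, hs⟩ := Module.projective_lifting_property f LinearMap.id hf_surj
  have hsx : ∀ y, f (s y) = y := LinearMap.congr_fun hs
  have hs_surj : Function.Surjective s := by
    rw [← LinearMap.range_eq_top]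
    refine h.superfluous _ (eq_top_iff.mpr fun x _ => ?_)
    refine Submodule.mem_sup.mpr ⟨s (f x), ⟨_, rfl⟩, x - s (f x), ?_, by abel⟩
    rw [LinearMap.mem_ker, map_sub, ← hfx, ← hfx, hsx, sub_self]
  exact ⟨(LinearEquiv.ofBijective s ⟨Function.LeftInverse.injective hsx, hs_surj⟩).symm⟩

theorem map_moduleSocle_le (a : P ≃ₗ[R] P') :
    (moduleSocle R P).map a.toLinearMap ≤ moduleSocle R P' := by
  rw [moduleSocle, Submodule.map_le_iff_le_comap]
  refine sSup_le fun N hN => Submodule.map_le_iff_le_comap.mp (le_sSup ?_)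
  have : IsSimpleModule R N := hN
  exact IsSimpleModule.congr (a.submoduleMap N).symm

/-- Isomorphic modules have isomorphic socles. -/
def moduleSocleCongr (a : P ≃ₗ[R] P') : moduleSocle R P ≃ₗ[R] moduleSocle R P' :=
  (a.submoduleMap (moduleSocle R P)).trans <| LinearEquiv.ofEq _ _ <|
    le_antisymm (map_moduleSocle_le a) fun y hy =>
      ⟨a.symm y, map_moduleSocle_le a.symm ⟨y, hy, rfl⟩, by simp⟩

/-- A simple submodule contained in every nonzero submodule is the socle. -/
theorem moduleSocle_eq_of_essential {X : Submodule R P} (hX : IsSimpleModule R X)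
    (h : ∀ N : Submodule R P, N ≠ ⊥ → X ≤ N) : moduleSocle R P = X := by
  refine le_antisymm (sSup_le fun N hN => ?_) (le_sSup hX)
  have hN' : IsAtom N := isSimpleModule_iff_isAtom.mp hN
  rcases hN'.le_iff.mp (h N hN'.1) with h0 | h0
  · exact absurd h0 (isSimpleModule_iff_isAtom.mp hX).1
  · exact h0.ge

end Covers

/-! ### Modules over a corner ring -/

section Corner

variable {A : Type} [Ring A] {e : A} (he : IsIdempotentElem e)
  {M N : Type} [AddCommGroup M] [Module A M] [AddCommGroup N] [Module A N]

theorem mem_cornerSubgroup_iff (he : IsIdempotentElem e) {x : M} : x ∈ cornerSubgroup e M ↔ e • x = x :=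
  ⟨fun ⟨y, hy⟩ => by
    change e • y = x at hy
    rw [← hy, smul_smul, he.eq], fun h => ⟨x, h⟩⟩

/-- The element `e a e` of the corner ring. -/
def cornerElement (a : A) : he.Corner :=
  ⟨e * a * e, (Subsemigroup.mem_corner_iff he).mpr
    ⟨by rw [← mul_assoc, ← mul_assoc, he.eq], by rw [mul_assoc, he.eq]⟩⟩

theorem coe_corner_smul (a : he.Corner) (x : cornerSubgroup e M) :
    ((a • x : cornerSubgroup e M) : M) = a.1 • x.1 := rfl

theorem coe_cornerElement_smul (a : A) (x : cornerSubgroup e M) :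
    ((cornerElement he a • x : cornerSubgroup e M) : M) = (e * a) • x.1 := by
  rw [coe_corner_smul]
  change (e * a * e) • x.1 = _
  rw [mul_smul, (mem_cornerSubgroup_iff he).mp x.2]

/-- The map `e M → e N` induced by a linear map `M → N`. -/
def cornerMap (f : M →ₗ[A] N) : cornerSubgroup e M →ₗ[he.Corner] cornerSubgroup e N where
  toFun x := ⟨f x.1, (mem_cornerSubgroup_iff he).mpr <| by
    rw [← map_smul, (mem_cornerSubgroup_iff he).mp x.2]⟩
  map_add' x y := Subtype.ext (map_add f _ _)
  map_smul' a x := Subtype.ext (map_smul f _ _)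

theorem cornerMap_surjective {f : M →ₗ[A] N} (hf : Function.Surjective f) :
    Function.Surjective (cornerMap he f) := by
  rintro ⟨y, hy⟩
  obtain ⟨x, rfl⟩ := hf y
  refine ⟨⟨e • x, x, rfl⟩, Subtype.ext ?_⟩
  change f (e • x) = f x
  rw [map_smul]
  exact (mem_cornerSubgroup_iff he).mp hy

/-- The `A`-submodule generated by an `e A e`-submodule of `e M`. -/
def cornerSpan (X : Submodule he.Corner (cornerSubgroup e M)) : Submodule A M :=
  Submodule.span A (Subtype.val '' (X : Set (cornerSubgroup e M)))

theorem mem_cornerSpan_of_mem {X : Submodule he.Corner (cornerSubgroup e M)}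
    {x : cornerSubgroup e M} (hx : x ∈ X) : x.1 ∈ cornerSpan he X :=
  Submodule.subset_span ⟨x, hx, rfl⟩

/-- On eM the element ea acts as eae, so e(AX) = (eAe)X ⊆ X. This carries submodule arguments from M
to eM. -/
theorem mem_of_mem_cornerSpan {X : Submodule he.Corner (cornerSubgroup e M)}
    {x : cornerSubgroup e M} (hx : x.1 ∈ cornerSpan he X) : x ∈ X := by
  -- Quantifying over all a lets the induction absorb scalar multiples; only a = 1 is used at the
  -- end.
  have key : ∀ y ∈ cornerSpan he X, ∀ a : A, ∃ z ∈ X, z.1 = (e * a) • y := by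
    intro y hy
    induction hy using Submodule.span_induction with
    | mem y hy =>
      obtain ⟨z, hz, rfl⟩ := hy
      exact fun a => ⟨_, X.smul_mem (cornerElement he a) hz, coe_cornerElement_smul he a z⟩
    | zero => exact fun a => ⟨0, X.zero_mem, by simp⟩
    | add y y' _ _ h h' =>
      intro a
      obtain ⟨z, hz, h⟩ := h a
      obtain ⟨z', hz', h'⟩ := h' a
      exact ⟨z + z', X.add_mem hz hz', by rw [smul_add, ← h, ← h']; rfl⟩
    | smul b y _ h =>
      intro a
      obtain ⟨z, hz, h⟩ := h (a * b)
      exact ⟨z, hz, by rw [h, smul_smul, mul_assoc]⟩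
  obtain ⟨z, hz, h⟩ := key x.1 hx 1
  rw [mul_one, (mem_cornerSubgroup_iff he).mp x.2] at h
  rwa [← Subtype.ext h]

theorem cornerSpan_ne_bot {X : Submodule he.Corner (cornerSubgroup e M)} (hX : X ≠ ⊥) :
    cornerSpan he X ≠ ⊥ := by
  obtain ⟨x, hx, hx0⟩ := Submodule.exists_mem_ne_zero_of_ne_bot hX
  intro h
  have := mem_cornerSpan_of_mem he hx
  rw [h, Submodule.mem_bot] at this
  exact hx0 (Subtype.ext this)

theorem isSimpleModule_cornerSubgroup [IsSimpleModule A M] (h : Nontrivial (cornerSubgroup e M)) :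
    IsSimpleModule he.Corner (cornerSubgroup e M) := by
  rw [isSimpleModule_iff]
  refine { exists_pair_ne := exists_pair_ne _, eq_bot_or_eq_top := fun X => ?_ }
  refine or_iff_not_imp_left.mpr fun hX => eq_top_iff.mpr fun x _ => mem_of_mem_cornerSpan he ?_
  rw [(eq_bot_or_eq_top (cornerSpan he X)).resolve_left (cornerSpan_ne_bot he hX)]
  exact Submodule.mem_top

/-- The functor `M ↦ e M` preserves superfluous kernels of maps to simple modules not killed
by `e`. -/
theorem cornerMap_superfluous [IsSimpleModule A N] (h : Nontrivial (cornerSubgroup e N))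
    {π : M →ₗ[A] N} (hπ : Function.Surjective π)
    (hs : ∀ X : Submodule A M, X ⊔ LinearMap.ker π = ⊤ → X = ⊤)
    (X : Submodule he.Corner (cornerSubgroup e M))
    (hX : X ⊔ LinearMap.ker (cornerMap he π) = ⊤) : X = ⊤ := by
  have hker : IsCoatom (LinearMap.ker π) := by
    rw [← isSimpleModule_iff_isCoatom]
    exact IsSimpleModule.congr (π.quotKerEquivOfSurjective hπ)
  -- If AX lies in ker π, then X lies in the kernel of eM → eN, so that map is zero although it is
  -- onto eN ≠ 0. Otherwise AX + ker π = M because ker π is maximal, and superfluousness gives AX =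
  -- M.
  by_cases hle : cornerSpan he X ≤ LinearMap.ker π
  · exfalso
    have hX' : X ≤ LinearMap.ker (cornerMap he π) := fun x hx =>
      LinearMap.mem_ker.mpr (Subtype.ext (hle (mem_cornerSpan_of_mem he hx)))
    rw [sup_eq_right.mpr hX', LinearMap.ker_eq_top] at hX
    obtain ⟨y, hy⟩ := exists_ne (0 : cornerSubgroup e N)
    obtain ⟨x, rfl⟩ := cornerMap_surjective he hπ y
    exact hy (by rw [hX]; rfl)
  · have := hs (cornerSpan he X) (by
      rw [sup_comm]
      exact hker.2 _ (left_lt_sup.mpr hle))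
    exact eq_top_iff.mpr fun x _ => mem_of_mem_cornerSpan he (by rw [this]; exact Submodule.mem_top)

/-- The socle of `e M`, if `M` has a simple submodule contained in all nonzero submodules. -/
theorem nonempty_moduleSocle_cornerSubgroup_equiv [IsSimpleModule A N]
    (h : Nontrivial (cornerSubgroup e N)) {τ : N →ₗ[A] M} (hτ : Function.Injective τ)
    (hess : ∀ X : Submodule A M, X ≠ ⊥ → LinearMap.range τ ≤ X) :
    Nonempty (moduleSocle he.Corner (cornerSubgroup e M) ≃ₗ[he.Corner] cornerSubgroup e N) := by
  have hinj : Function.Injective (cornerMap he τ) := fun x y hxy =>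
    Subtype.ext (hτ (congrArg Subtype.val hxy))
  let E := LinearEquiv.ofInjective _ hinj
  have := isSimpleModule_cornerSubgroup he h
  have hsoc : moduleSocle he.Corner (cornerSubgroup e M) = LinearMap.range (cornerMap he τ) := by
    refine moduleSocle_eq_of_essential (IsSimpleModule.congr E.symm) fun X hX => ?_
    rintro _ ⟨x, rfl⟩
    exact mem_of_mem_cornerSpan he (hess _ (cornerSpan_ne_bot he hX) ⟨x.1, rfl⟩)
  exact ⟨(LinearEquiv.ofEq _ _ hsoc).trans E.symm⟩

end Corner

/-! ### Basic systems of idempotents -/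

section Basic

variable {A : Type} [Ring A] {P S : Type} [AddCommGroup P] [Module A P] [AddCommGroup S]
  [Module A S]

/-- A module with a nonzero submodule contained in all nonzero submodules is indecomposable. -/
theorem isIndecomposableModule_of_essential {T : Submodule A P} (hT : T ≠ ⊥)
    (h : ∀ N : Submodule A P, N ≠ ⊥ → T ≤ N) : IsIndecomposableModule A P := by
  refine ⟨?_, fun N N' hN => ?_⟩
  · obtain ⟨x, -, hx⟩ := Submodule.exists_mem_ne_zero_of_ne_bot hT
    exact ⟨x, 0, hx⟩
  · by_contra! hc
    exact hT (le_bot_iff.mp (hN.inf_eq_bot ▸ le_inf (h N hc.1) (h N' hc.2)))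

/-- A simple quotient of a module with a simple quotient whose kernel is superfluous is isomorphic
to the latter. -/
theorem nonempty_equiv_of_superfluous_ker {S' : Type} [AddCommGroup S'] [Module A S']
    [IsSimpleModule A S] [IsSimpleModule A S'] {π : P →ₗ[A] S} (hπ : Function.Surjective π)
    (hs : ∀ X : Submodule A P, X ⊔ LinearMap.ker π = ⊤ → X = ⊤)
    {f : P →ₗ[A] S'} (hf : f ≠ 0) : Nonempty (S ≃ₗ[A] S') := by
  have hf_surj : Function.Surjective f := LinearMap.surjective_of_ne_zero hf
  have hπ_ker : IsCoatom (LinearMap.ker π) := by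
    rw [← isSimpleModule_iff_isCoatom]
    exact IsSimpleModule.congr (π.quotKerEquivOfSurjective hπ)
  have hf_ker : IsCoatom (LinearMap.ker f) := by
    rw [← isSimpleModule_iff_isCoatom]
    exact IsSimpleModule.congr (f.quotKerEquivOfSurjective hf_surj)
  -- Two distinct maximal submodules would sum to P, against the superfluousness of ker π.
  have heq : LinearMap.ker f = LinearMap.ker π := by
    by_contra hne
    exact hf_ker.1 (hs _ (hf_ker.sup_eq_top_of_ne hπ_ker hne))
  exact ⟨(π.quotKerEquivOfSurjective hπ).symm.trans
    ((Submodule.quotEquivOfEq _ _ heq.symm).trans (f.quotKerEquivOfSurjective hf_surj))⟩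

variable {ι : Type} {e : ι → A}

/-- The indecomposable projective modules of `A` are generated by an element whose annihilator is
that of some `e k`. -/
theorem IsBasicSystem.exists_generator (he : IsBasicSystem e) [Module.Finite A P]
    [Module.Projective A P] (hP : IsIndecomposableModule A P) :
    ∃ (k : ι) (φ : P ≃ₗ[A] Ideal.span {e k}) (p : P), e k • p = p ∧
      ∀ x : P, (φ x).1 • p = x := by
  obtain ⟨k, ⟨φ⟩⟩ := he.complete (ModuleCat.of A P) ‹_› ‹_› hP
  have hidem := he.orthogonal.idem k
  refine ⟨k, φ, φ.symm ⟨e k, Ideal.mem_span_singleton_self _⟩, ?_, fun x => ?_⟩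
  · rw [← map_smul]
    congr 1
    exact Subtype.ext hidem.eq
  · apply φ.injective
    rw [map_smul, φ.apply_symm_apply]
    obtain ⟨a, ha⟩ := Ideal.mem_span_singleton'.mp (φ x).2
    refine Subtype.ext ?_
    change (φ x).1 * e k = (φ x).1
    rw [← ha, mul_assoc, hidem.eq]

/-- Since P ≅ Aeₖ, homomorphisms P → S' correspond to elements of eₖS'. Thus eₖ detects which
modules receive a nonzero map from P. -/
theorem IsBasicSystem.exists_smul_ne_zero (he : IsBasicSystem e) [Module.Finite A P]
    [Module.Projective A P] (hP : IsIndecomposableModule A P) [Nontrivial S] {π : P →ₗ[A] S}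
    (hπ : Function.Surjective π) :
    ∃ k, (∃ s : S, e k • s ≠ 0) ∧ ∀ (S' : Type) [AddCommGroup S'] [Module A S'] (s : S'),
      e k • s ≠ 0 → ∃ f : P →ₗ[A] S', f ≠ 0 := by
  obtain ⟨k, φ, p, hp, hφ⟩ := he.exists_generator hP
  refine ⟨k, ⟨π p, fun h => ?_⟩, fun S' _ _ s hs => ?_⟩
  · obtain ⟨s, hs⟩ := exists_ne (0 : S)
    obtain ⟨x, rfl⟩ := hπ s
    rw [← map_smul, hp] at h
    exact hs (by rw [← hφ x, map_smul, h, smul_zero])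
  · refine ⟨(LinearMap.toSpanSingleton A S' s) ∘ₗ (Submodule.subtype _) ∘ₗ φ.toLinearMap,
      fun h => hs ?_⟩
    have := LinearMap.congr_fun h (φ.symm ⟨e k, Ideal.mem_span_singleton_self _⟩)
    simpa using this

variable [Fintype ι]

theorem OrthogonalIdempotents.sum_mul_self (he : OrthogonalIdempotents e) (k : ι) :
    (∑ i, e i) * e k = e k := by
  classical
  rw [Finset.sum_mul, Finset.sum_eq_single k (fun i _ hi => he.ortho hi) (by simp)]
  exact he.idem k

theorem OrthogonalIdempotents.self_mul_sum (he : OrthogonalIdempotents e) (k : ι) :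
    e k * (∑ i, e i) = e k := by
  classical
  rw [Finset.mul_sum, Finset.sum_eq_single k (fun i _ hi => he.ortho hi.symm) (by simp)]
  exact he.idem k

/-- From P ≅ Aeₖ one gets eP ≅ eAeₖ, a direct summand of eAe because eₖ lies in eAe. -/
theorem IsBasicSystem.projective_cornerSubgroup (he : IsBasicSystem e) [Module.Finite A P]
    [Module.Projective A P] (hP : IsIndecomposableModule A P) :
    Module.Projective he.basicAlgebra (cornerSubgroup (∑ i, e i) P) := by
  obtain ⟨k, φ, p, hp, hφ⟩ := he.exists_generator hP
  have hp' : p ∈ cornerSubgroup (∑ i, e i) P := (mem_cornerSubgroup_iff he.isIdempotentElem).mpr <| by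
    rw [← hp, smul_smul, he.orthogonal.sum_mul_self]
  let f : cornerSubgroup (∑ i, e i) P →ₗ[he.basicAlgebra] he.basicAlgebra :=
    { toFun := fun x => ⟨(φ x.1).1, (Subsemigroup.mem_corner_iff he.isIdempotentElem).mpr ⟨by
        have := congrArg (fun y => (φ y).1) ((mem_cornerSubgroup_iff he.isIdempotentElem).mp x.2)
        simpa using this, by
        obtain ⟨a, ha⟩ := Ideal.mem_span_singleton'.mp (φ x.1).2
        rw [← ha, mul_assoc, he.orthogonal.self_mul_sum]⟩⟩
      map_add' := fun x y => Subtype.ext (by simp; rfl)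
      map_smul' := fun a x => Subtype.ext (by simp [coe_corner_smul]; rfl) }
  refine Module.Projective.of_split f (LinearMap.toSpanSingleton _ _ ⟨p, hp'⟩) ?_
  refine LinearMap.ext fun x => Subtype.ext ?_
  exact hφ x.1

theorem IsBasicSystem.nontrivial_cornerSubgroup (he : IsBasicSystem e) [Module.Finite A P]
    [Module.Projective A P] (hP : IsIndecomposableModule A P) [Nontrivial S] {π : P →ₗ[A] S}
    (hπ : Function.Surjective π) : Nontrivial (cornerSubgroup (∑ i, e i) S) := by
  obtain ⟨k, ⟨s, hs⟩, -⟩ := he.exists_smul_ne_zero hP hπ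
  exact ⟨⟨e k • s, (mem_cornerSubgroup_iff he.isIdempotentElem).mpr <| by
    rw [smul_smul, he.orthogonal.sum_mul_self]⟩, 0, fun h => hs (congrArg Subtype.val h)⟩

/-- Simple tops of indecomposable projective modules are determined by their images over the basic
algebra. -/
theorem IsBasicSystem.nonempty_equiv_of_corner_equiv (he : IsBasicSystem e) [Module.Finite A P]
    [Module.Projective A P] (hP : IsIndecomposableModule A P) {S' : Type} [AddCommGroup S']
    [Module A S'] [IsSimpleModule A S] [IsSimpleModule A S'] {π : P →ₗ[A] S}
    (hπ : Function.Surjective π)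
    (hs : ∀ X : Submodule A P, X ⊔ LinearMap.ker π = ⊤ → X = ⊤)
    (E : cornerSubgroup (∑ i, e i) S ≃ₗ[he.basicAlgebra] cornerSubgroup (∑ i, e i) S') :
    Nonempty (S ≃ₗ[A] S') := by
  have := IsSimpleModule.nontrivial A S
  obtain ⟨k, ⟨s, hk⟩, hk'⟩ := he.exists_smul_ne_zero hP hπ
  let x : cornerSubgroup (∑ i, e i) S :=
    ⟨e k • s, (mem_cornerSubgroup_iff he.isIdempotentElem).mpr <| by
      rw [smul_smul, he.orthogonal.sum_mul_self]⟩
  -- This element of eAe acts as eₖ on every eN, so E carries the nonzero vector eₖs to a vector not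
  -- killed by eₖ; that vector yields a nonzero map P → S'.
  let c := cornerElement he.isIdempotentElem (e k)
  have hc : ∀ {N : Type} [AddCommGroup N] [Module A N] (y : cornerSubgroup (∑ i, e i) N),
      ((c • y : cornerSubgroup (∑ i, e i) N) : N) = e k • y.1 := fun y => by
    rw [coe_cornerElement_smul, he.orthogonal.sum_mul_self]
  have hx : c • x = x := Subtype.ext <| by
    rw [hc, smul_smul, (he.orthogonal.idem k).eq]
  have hEx : e k • (E x).1 ≠ 0 := by
    rw [← hc, ← map_smul, hx]
    intro h
    exact hk (congrArg Subtype.val ((LinearEquiv.map_eq_zero_iff E).mp (Subtype.ext h)))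
  obtain ⟨f, hf⟩ := hk' S' _ hEx
  exact nonempty_equiv_of_superfluous_ker hπ hs hf

end Basic

/-! ### Inflated and induced modules over the skew group algebra -/

section Modules

variable {m : ℕ} {G : Subgroup (GL (Fin m) ℂ)} {V W : Type} [AddCommGroup V] [Module ℂ V]
  [AddCommGroup W] [Module ℂ W]

local notation "Λ" => ExteriorAlgebra ℂ (Fin m → ℂ)

/-- The space of a representation of `G`, as a module over the skew group algebra on which `ℂᵐ`
acts as `0`. -/
def InflatedModule (_ρ : Representation ℂ G V) : Type := V

instance (ρ : Representation ℂ G V) : AddCommGroup (InflatedModule ρ) :=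
  inferInstanceAs (AddCommGroup V)

instance (ρ : Representation ℂ G V) : Module ℂ (InflatedModule ρ) :=
  inferInstanceAs (Module ℂ V)

instance (ρ : Representation ℂ G V) : Module (SkewGroupAlgebra G) (InflatedModule ρ) :=
  Module.compHom V (inflate ρ)

theorem InflatedModule.single_smul (ρ : Representation ℂ G V) (g : G) (x : Λ)
    (v : InflatedModule ρ) :
    (SkewMonoidAlgebra.single g x : SkewGroupAlgebra G) • v =
      ExteriorAlgebra.algebraMapInv x • (show InflatedModule ρ from ρ g v) := by
  change inflate ρ (SkewMonoidAlgebra.single g x) v = _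
  have : inflate ρ (SkewMonoidAlgebra.single g x) =
      algebraMap ℂ (Module.End ℂ V) (ExteriorAlgebra.algebraMapInv x) * ρ g :=
    SkewMonoidAlgebra.liftNC_single _ _ _ _
  rw [this]
  rfl

/-- The action of `G` on the exterior algebra, as a representation. -/
def exteriorRep (G : Subgroup (GL (Fin m) ℂ)) : Representation ℂ G Λ where
  toFun g := (ExteriorAlgebra.map (Matrix.mulVecLin g.1.val)).toLinearMap
  map_one' := LinearMap.ext fun x => one_smul (GL (Fin m) ℂ) x
  map_mul' g h := LinearMap.ext fun x => mul_smul g.1 h.1 x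

theorem exteriorRep_apply (g : G) (x : Λ) : exteriorRep G g x = g • x := rfl

/-- The action of the skew group algebra on `⋀ℂᵐ ⊗ V`. -/
def inducedAction (ρ : Representation ℂ G V) :
    SkewGroupAlgebra G →+* Module.End ℂ (Λ ⊗[ℂ] V) :=
  SkewMonoidAlgebra.liftNCRingHom ((Algebra.lsmul ℂ ℂ (Λ ⊗[ℂ] V) : Λ →ₐ[ℂ] Module.End ℂ (Λ ⊗[ℂ] V)) : Λ →+* Module.End ℂ (Λ ⊗[ℂ] V))
    ((exteriorRep G).tprod ρ) (by
      intro x g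
      refine TensorProduct.ext' fun y v => ?_
      change (g • x) • ((g • y) ⊗ₜ[ℂ] ρ g v) =
        (exteriorRep G).tprod ρ g (x • (y ⊗ₜ[ℂ] v) : Λ ⊗[ℂ] V)
      simp [TensorProduct.smul_tmul', exteriorRep_apply])

/-- The module `⋀ℂᵐ ⊗ V` over the skew group algebra. -/
def InducedModule (_ρ : Representation ℂ G V) : Type := Λ ⊗[ℂ] V

instance (ρ : Representation ℂ G V) : AddCommGroup (InducedModule ρ) :=
  inferInstanceAs (AddCommGroup (Λ ⊗[ℂ] V))

instance (ρ : Representation ℂ G V) : Module ℂ (InducedModule ρ) :=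
  inferInstanceAs (Module ℂ (Λ ⊗[ℂ] V))

instance (ρ : Representation ℂ G V) : Module Λ (InducedModule ρ) :=
  inferInstanceAs (Module Λ (Λ ⊗[ℂ] V))

instance (ρ : Representation ℂ G V) : Module (SkewGroupAlgebra G) (InducedModule ρ) :=
  Module.compHom (Λ ⊗[ℂ] V) (inducedAction ρ)

/-- Pure tensors in `⋀ℂᵐ ⊗ V`. -/
def InducedModule.tmul (ρ : Representation ℂ G V) (x : Λ) (v : V) : InducedModule ρ := x ⊗ₜ v

theorem InducedModule.single_smul (ρ : Representation ℂ G V) (g : G) (x : Λ)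
    (p : InducedModule ρ) :
    (SkewMonoidAlgebra.single g x : SkewGroupAlgebra G) • p =
      x • (show InducedModule ρ from (exteriorRep G).tprod ρ g p) := by
  change inducedAction ρ (SkewMonoidAlgebra.single g x) p = _
  have : inducedAction ρ (SkewMonoidAlgebra.single g x) =
      (Algebra.lsmul ℂ ℂ (Λ ⊗[ℂ] V) : Λ →ₐ[ℂ] Module.End ℂ (Λ ⊗[ℂ] V)) x * (exteriorRep G).tprod ρ g :=
    SkewMonoidAlgebra.liftNC_single _ _ _ _
  rw [this]
  rfl

theorem InducedModule.single_smul_tmul (ρ : Representation ℂ G V) (g : G) (x y : Λ) (v : V) :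
    (SkewMonoidAlgebra.single g x : SkewGroupAlgebra G) • InducedModule.tmul ρ y v =
      InducedModule.tmul ρ (x * g • y) (ρ g v) :=
  InducedModule.single_smul ρ g x _

theorem InducedModule.single_one_smul (ρ : Representation ℂ G V) (x : Λ) (p : InducedModule ρ) :
    (SkewMonoidAlgebra.single 1 x : SkewGroupAlgebra G) • p = x • p := by
  rw [InducedModule.single_smul, map_one]
  rfl

/-- An additive map is linear over the skew group algebra if it respects the action of the
elements `x g`. -/
def skewLinearMap {M N : Type} [AddCommGroup M] [Module (SkewGroupAlgebra G) M] [AddCommGroup N]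
    [Module (SkewGroupAlgebra G) N] (f : M →+ N)
    (h : ∀ (g : G) (x : Λ) (p : M), f ((SkewMonoidAlgebra.single g x : SkewGroupAlgebra G) • p) =
      (SkewMonoidAlgebra.single g x : SkewGroupAlgebra G) • f p) :
    M →ₗ[SkewGroupAlgebra G] N where
  toFun := f
  map_add' := map_add f
  map_smul' a p := by
    induction a using SkewMonoidAlgebra.induction_on with
    | zero => simp
    | single g x => exact h g x p
    | add a b ha hb => simp_all [add_smul]

theorem augmentation_smul (x : Λ) (p : Λ ⊗[ℂ] V) :
    augmentation m V (x • p) = ExteriorAlgebra.algebraMapInv x • augmentation m V p := by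
  induction p with
  | zero => simp
  | tmul y v => simp [TensorProduct.smul_tmul', mul_smul]
  | add p q hp hq => rw [smul_add, map_add, map_add, hp, hq, smul_add]

theorem augmentation_tprod (ρ : Representation ℂ G V) (g : G) (p : Λ ⊗[ℂ] V) :
    augmentation m V ((exteriorRep G).tprod ρ g p) = ρ g (augmentation m V p) := by
  have h (y : Λ) : ExteriorAlgebra.algebraMapInv (g • y) = ExteriorAlgebra.algebraMapInv y :=
    algebraMapInv_smul g.1 y
  induction p with
  | zero => simp
  | tmul y v => simp [exteriorRep_apply, h]
  | add p q hp hq => rw [map_add, map_add, map_add, map_add, hp, hq]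

/-- The projection `⋀ℂᵐ ⊗ V → V`. -/
def InducedModule.toInflated (ρ : Representation ℂ G V) :
    InducedModule ρ →ₗ[SkewGroupAlgebra G] InflatedModule ρ :=
  skewLinearMap (augmentation m V).toAddMonoidHom fun g x p => by
    rw [InducedModule.single_smul, InflatedModule.single_smul]
    exact (augmentation_smul x _).trans (congrArg _ (augmentation_tprod ρ g p))

theorem InducedModule.toInflated_surjective (ρ : Representation ℂ G V) :
    Function.Surjective (InducedModule.toInflated ρ) := fun v =>
  ⟨InducedModule.tmul ρ 1 v, by
    have : augmentation m V ((1 : Λ) ⊗ₜ[ℂ] (show V from v)) = v := by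
      rw [augmentation_tmul, map_one, one_smul]
    exact this⟩

theorem mul_topElement (x : Λ) :
    x * topElement m = ExteriorAlgebra.algebraMapInv x • topElement m := by
  induction x using ExteriorAlgebra.induction with
  | algebraMap r =>
    rw [← Algebra.smul_def]
    congr 1
    exact (ExteriorAlgebra.algebraMap_leftInverse _ r).symm
  | ι v => simp [ι_mul_topElement, ExteriorAlgebra.algebraMapInv]
  | mul a b ha hb => rw [mul_assoc, hb, mul_smul_comm, ha, map_mul, smul_smul, mul_comm]
  | add a b ha hb => rw [add_mul, ha, hb, map_add, add_smul]

/-- The inclusion of the top degree part in `⋀ℂᵐ ⊗ V`. -/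
def InducedModule.ofTop (ρ : Representation ℂ G V) :
    InflatedModule (ρ.twist (detChar G)) →ₗ[SkewGroupAlgebra G] InducedModule ρ :=
  skewLinearMap (TensorProduct.mk ℂ Λ V (topElement m)).toAddMonoidHom fun g x v => by
    rw [InflatedModule.single_smul]
    refine Eq.trans ?_ (InducedModule.single_smul_tmul ρ g x (topElement m) v).symm
    -- The determinant by which g scales the top degree is moved across the tensor sign, where it
    -- becomes the twist of ρ.
    have : g • topElement m = g.1.val.det • topElement m := smul_topElement g.1
    rw [this, mul_smul_comm, mul_topElement]
    change topElement m ⊗ₜ[ℂ] (ExteriorAlgebra.algebraMapInv x • (g.1.val.det • ρ g v)) =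
      (g.1.val.det • ExteriorAlgebra.algebraMapInv x • topElement m) ⊗ₜ[ℂ] (ρ g v)
    rw [TensorProduct.smul_tmul, TensorProduct.smul_tmul, smul_comm]

theorem InducedModule.ofTop_injective (ρ : Representation ℂ G V) :
    Function.Injective (InducedModule.ofTop ρ) := topElement_tmul_injective

theorem InducedModule.exterior_smul_mem {ρ : Representation ℂ G V}
    (N : Submodule (SkewGroupAlgebra G) (InducedModule ρ)) (x : Λ) {p : InducedModule ρ}
    (hp : p ∈ N) : x • p ∈ N := by
  rw [← InducedModule.single_one_smul]
  exact N.smul_mem _ hp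

end Modules

section Modules

variable {m : ℕ} {G : Subgroup (GL (Fin m) ℂ)} {V W : Type} [AddCommGroup V] [Module ℂ V]
  [AddCommGroup W] [Module ℂ W]

local notation "Λ" => ExteriorAlgebra ℂ (Fin m → ℂ)

/-! ### The kernel of the projection is superfluous -/

theorem sub_one_tmul_augmentation_mem_span (p : Λ ⊗[ℂ] V) :
    p - 1 ⊗ₜ augmentation m V p ∈
      Submodule.span ℂ {z : Λ ⊗[ℂ] V | ∃ (v : Fin m → ℂ) (q : Λ ⊗[ℂ] V),
        z = ExteriorAlgebra.ι ℂ v • q} := by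
  induction p with
  | zero => simp
  | tmul x s =>
    have h : x ⊗ₜ[ℂ] s - 1 ⊗ₜ augmentation m V (x ⊗ₜ s) =
        (x - algebraMap ℂ Λ (ExteriorAlgebra.algebraMapInv x)) ⊗ₜ s := by
      rw [augmentation_tmul, TensorProduct.sub_tmul, ← TensorProduct.smul_tmul,
        Algebra.algebraMap_eq_smul_one]
    rw [h]
    have hx := sub_algebraMapInv_mem_span x
    generalize x - algebraMap ℂ Λ (ExteriorAlgebra.algebraMapInv x) = y at hx
    induction hx using Submodule.span_induction with
    | mem z hz =>
      obtain ⟨v, y, rfl⟩ := hz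
      exact Submodule.subset_span ⟨v, y ⊗ₜ s, rfl⟩
    | zero => simp
    | add a b _ _ ha hb => rw [TensorProduct.add_tmul]; exact add_mem ha hb
    | smul c a _ ha => rw [← TensorProduct.smul_tmul']; exact Submodule.smul_mem _ c ha
  | add p q hp hq =>
    have := add_mem hp hq
    convert this using 1
    rw [map_add, TensorProduct.tmul_add]
    abel

/-- Nakayama's lemma for a nilpotent ideal: the whole module is N plus multiples of vectors, and
substituting this into itself leaves a remainder of products of m + 1 vectors, which vanish. -/
theorem eq_top_of_forall_exists_sub_mem_ker {N : AddSubgroup (Λ ⊗[ℂ] V)}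
    (hN : ∀ (x : Λ), ∀ p ∈ N, x • p ∈ N)
    (h : ∀ p, ∃ n ∈ N, augmentation m V (p - n) = 0) : N = ⊤ := by
  -- Here d bounds the number of factors missing for the product to vanish; the claim is wanted for
  -- the empty list.
  have key : ∀ (d : ℕ) (l : List (Fin m → ℂ)), m + 1 ≤ l.length + d →
      ∀ p : Λ ⊗[ℂ] V, (l.map (ExteriorAlgebra.ι ℂ)).prod • p ∈ N := by
    intro d
    induction d with
    | zero =>
      intro l hl p
      rw [prod_map_ι_eq_zero (by omega), zero_smul]
      exact N.zero_mem
    | succ d ih =>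
      intro l hl p
      obtain ⟨n, hn, hp⟩ := h p
      have h1 := sub_one_tmul_augmentation_mem_span (p - n)
      rw [hp, TensorProduct.tmul_zero, sub_zero] at h1
      have h2 : (l.map (ExteriorAlgebra.ι ℂ)).prod • (p - n) ∈ N := by
        generalize p - n = r at h1
        induction h1 using Submodule.span_induction with
        | mem z hz =>
          obtain ⟨v, q, rfl⟩ := hz
          have := ih (l ++ [v]) (by simp; omega) q
          simpa [smul_smul] using this
        | zero => simp [N.zero_mem]
        | add a b _ _ ha hb => rw [smul_add]; exact N.add_mem ha hb
        | smul c a _ ha =>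
          rw [smul_comm, ← algebraMap_smul Λ c]
          exact hN _ _ ha
      have h3 := N.add_mem h2 (hN (l.map (ExteriorAlgebra.ι ℂ)).prod n hn)
      rwa [← smul_add, sub_add_cancel] at h3
  refine (AddSubgroup.eq_top_iff' N).mpr fun p => ?_
  simpa using key (m + 1) [] (by simp) p

theorem InducedModule.ker_toInflated_superfluous (ρ : Representation ℂ G V)
    (N : Submodule (SkewGroupAlgebra G) (InducedModule ρ))
    (hN : N ⊔ LinearMap.ker (InducedModule.toInflated ρ) = ⊤) : N = ⊤ := by
  have := eq_top_of_forall_exists_sub_mem_ker (m := m) (V := V) (N := N.toAddSubgroup)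
    (fun x p hp => InducedModule.exterior_smul_mem N x hp) fun p => by
      have hp : (show InducedModule ρ from p) ∈
          N ⊔ LinearMap.ker (InducedModule.toInflated ρ) := by rw [hN]; exact Submodule.mem_top
      obtain ⟨n, hn, q, hq, hnq⟩ := Submodule.mem_sup.mp hp
      refine ⟨n, hn, ?_⟩
      have : q = (show InducedModule ρ from p) - n := by rw [← hnq]; abel
      rw [this] at hq
      exact hq
  exact Submodule.toAddSubgroup_injective this

/-! ### The top degree part is contained in every nonzero submodule -/

/-- Multiply an element of N by vectors as long as the result stays nonzero. This stops after at
most m steps at an element killed by all vectors, which therefore has top degree. -/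
theorem exists_topElement_tmul_mem {N : AddSubgroup (Λ ⊗[ℂ] V)}
    (hN : ∀ (x : Λ), ∀ p ∈ N, x • p ∈ N) {p : Λ ⊗[ℂ] V} (hp : p ∈ N) (hp0 : p ≠ 0) :
    ∃ s : V, s ≠ 0 ∧ topElement m ⊗ₜ s ∈ N := by
  have key : ∀ (d : ℕ), (∃ q ∈ N, q ≠ 0 ∧ ∀ l : List (Fin m → ℂ), l.length = d + 1 →
      (l.map (ExteriorAlgebra.ι ℂ)).prod • q = 0) →
      ∃ q ∈ N, q ≠ 0 ∧ ∀ v : Fin m → ℂ, ExteriorAlgebra.ι ℂ v • q = 0 := by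
    intro d
    induction d with
    | zero =>
      rintro ⟨q, hq, hq0, h⟩
      exact ⟨q, hq, hq0, fun v => by simpa using h [v] rfl⟩
    | succ d ih =>
      rintro ⟨q, hq, hq0, h⟩
      by_cases h' : ∀ v : Fin m → ℂ, ExteriorAlgebra.ι ℂ v • q = 0
      · exact ⟨q, hq, hq0, h'⟩
      · obtain ⟨v, hv⟩ := not_forall.mp h'
        refine ih ⟨_, hN (ExteriorAlgebra.ι ℂ v) q hq, hv, fun l hl => ?_⟩
        have := h (l ++ [v]) (by simp [hl])
        simpa [smul_smul] using this
  obtain ⟨q, hq, hq0, h⟩ := key m ⟨p, hp, hp0, fun l hl => by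
    rw [prod_map_ι_eq_zero (by omega), zero_smul]⟩
  obtain ⟨s, rfl⟩ := exists_eq_topElement_tmul h
  exact ⟨s, fun hs => hq0 (by rw [hs, TensorProduct.tmul_zero]), hq⟩

/-- The s with top ⊗ s in N form a subrepresentation of ρ, nonzero by the previous lemma, hence
everything by irreducibility. -/
theorem InducedModule.range_ofTop_le (ρ : Representation ℂ G V) [hρ : ρ.IsIrreducible]
    (N : Submodule (SkewGroupAlgebra G) (InducedModule ρ)) (hN : N ≠ ⊥) :
    LinearMap.range (InducedModule.ofTop ρ) ≤ N := by
  have hsmul : ∀ (x : Λ), ∀ p ∈ N, x • p ∈ N := fun x p hp => InducedModule.exterior_smul_mem N x hp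
  have hsmul' : ∀ (c : ℂ) (s : V), InducedModule.tmul ρ (topElement m) s ∈ N →
      InducedModule.tmul ρ (topElement m) (c • s) ∈ N := fun c s hs => by
    have h : InducedModule.tmul ρ (topElement m) (c • s) =
        algebraMap ℂ Λ c • InducedModule.tmul ρ (topElement m) s := by
      change (topElement m) ⊗ₜ[ℂ] (c • s) = algebraMap ℂ Λ c • ((topElement m) ⊗ₜ[ℂ] s)
      rw [algebraMap_smul, TensorProduct.tmul_smul]
    rw [h]
    exact hsmul _ _ hs
  let U : Subrepresentation ρ :=
    { toSubmodule :=
        { carrier := {s | InducedModule.tmul ρ (topElement m) s ∈ N}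
          add_mem' := fun {a b} ha hb => by
            have h : InducedModule.tmul ρ (topElement m) (a + b) =
              InducedModule.tmul ρ (topElement m) a + InducedModule.tmul ρ (topElement m) b :=
                TensorProduct.tmul_add _ _ _
            change _ ∈ N
            rw [h]
            exact N.add_mem ha hb
          zero_mem' := by
            have h : InducedModule.tmul ρ (topElement m) 0 = 0 := TensorProduct.tmul_zero _ _
            change _ ∈ N
            rw [h]
            exact N.zero_mem
          smul_mem' := fun c s hs => hsmul' c s hs }
      apply_mem_toSubmodule := fun g s hs => by
        have h := (InducedModule.ofTop ρ).map_smul (SkewMonoidAlgebra.single g 1) s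
        have h1 : (SkewMonoidAlgebra.single g 1 : SkewGroupAlgebra G) •
            InducedModule.tmul ρ (topElement m) s ∈ N := N.smul_mem _ hs
        have h2 : InducedModule.tmul ρ (topElement m) (g.1.val.det • ρ g s) ∈ N := by
          have : InducedModule.tmul ρ (topElement m) (g.1.val.det • ρ g s) =
            (SkewMonoidAlgebra.single g 1 : SkewGroupAlgebra G) •
            InducedModule.tmul ρ (topElement m) s := by
              rw [InducedModule.single_smul_tmul, one_mul,
                show g • topElement m = g.1.val.det • topElement m from smul_topElement g.1]
              exact (TensorProduct.smul_tmul _ _ _).symm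
          rwa [this]
        -- The group acts on the top degree by det(g)ρ(g), so stability under ρ itself requires
        -- dividing by the determinant.
        have h3 := hsmul' (g.1.val.det)⁻¹ _ h2
        rwa [smul_smul, inv_mul_cancel₀ g.1.det_ne_zero, one_smul] at h3 }
  obtain ⟨p, hp, hp0⟩ := Submodule.exists_mem_ne_zero_of_ne_bot hN
  obtain ⟨s, hs0, hs⟩ := exists_topElement_tmul_mem (N := N.toAddSubgroup) hsmul hp hp0
  have hU : U = ⊤ := (eq_bot_or_eq_top U).resolve_left fun h => hs0 <| by
    have : s ∈ U.toSubmodule := hs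
    rw [h] at this
    exact (Submodule.mem_bot ℂ).mp this
  rintro _ ⟨s, rfl⟩
  have : s ∈ U.toSubmodule := by rw [hU]; exact Submodule.mem_top (R := ℂ) (M := V)
  exact this

/-! ### Inflated modules -/

theorem InflatedModule.algebraMap_smul (ρ : Representation ℂ G V) (c : ℂ) (v : InflatedModule ρ) :
    (SkewMonoidAlgebra.single 1 (algebraMap ℂ Λ c) : SkewGroupAlgebra G) • v = c • v := by
  rw [InflatedModule.single_smul, map_one, show ExteriorAlgebra.algebraMapInv
    (algebraMap ℂ Λ c) = c from ExteriorAlgebra.algebraMap_leftInverse _ c]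
  rfl

theorem InflatedModule.group_smul (ρ : Representation ℂ G V) (g : G) (v : InflatedModule ρ) :
    (SkewMonoidAlgebra.single g 1 : SkewGroupAlgebra G) • v =
      (show InflatedModule ρ from ρ g v) := by
  rw [InflatedModule.single_smul, map_one, one_smul]

instance InflatedModule.isSimpleModule (ρ : Representation ℂ G V) [hρ : ρ.IsIrreducible] :
    IsSimpleModule (SkewGroupAlgebra G) (InflatedModule ρ) := by
  let F : Submodule (SkewGroupAlgebra G) (InflatedModule ρ) → Subrepresentation ρ := fun N =>
    have hc : ∀ (c : ℂ) {v : InflatedModule ρ}, v ∈ N → c • v ∈ N := fun c v hv => by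
      rw [← InflatedModule.algebraMap_smul]
      exact N.smul_mem _ hv
    have hg : ∀ (g : G) {v : InflatedModule ρ}, v ∈ N → (show InflatedModule ρ from ρ g v) ∈ N :=
      fun g v hv => by
        rw [← InflatedModule.group_smul]
        exact N.smul_mem _ hv
    { toSubmodule :=
        { carrier := {v | (show InflatedModule ρ from v) ∈ N}
          add_mem' := fun ha hb => N.add_mem ha hb
          zero_mem' := N.zero_mem
          smul_mem' := hc }
      apply_mem_toSubmodule := hg }
  have hV : Nontrivial V := by
    by_contra h
    rw [not_nontrivial_iff_subsingleton] at h
    refine absurd (?_ : (⊥ : Subrepresentation ρ) = ⊤) bot_ne_top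
    exact Subrepresentation.ext (Subsingleton.elim _ _)
  rw [isSimpleModule_iff]
  refine { exists_pair_ne := ?_, eq_bot_or_eq_top := fun N => ?_ }
  · obtain ⟨v, hv⟩ := exists_ne (0 : V)
    refine ⟨⊥, ⊤, fun h => hv ?_⟩
    have h0 : ∀ w : InflatedModule ρ, w = 0 := fun w =>
      (Submodule.mem_bot (SkewGroupAlgebra G)).mp (by rw [h]; exact Submodule.mem_top)
    exact h0 v
  · rcases eq_bot_or_eq_top (F N) with h | h
    · refine Or.inl ((Submodule.eq_bot_iff _).mpr fun v hv => ?_)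
      have : v ∈ (F N).toSubmodule := hv
      rw [h] at this
      exact (Submodule.mem_bot ℂ).mp this
    · refine Or.inr (Submodule.eq_top_iff'.mpr fun v => ?_)
      have : v ∈ (F N).toSubmodule := by rw [h]; exact Submodule.mem_top (R := ℂ) (M := V)
      exact this

/-- Isomorphic representations have isomorphic inflations. -/
def InflatedModule.congr {ρ : Representation ℂ G V} {τ : Representation ℂ G W} (a : ρ.Equiv τ) :
    InflatedModule ρ ≃ₗ[SkewGroupAlgebra G] InflatedModule τ :=
  { skewLinearMap (M := InflatedModule ρ) (N := InflatedModule τ)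
      a.toLinearMap.toAddMonoidHom fun g x v => by
      rw [InflatedModule.single_smul, InflatedModule.single_smul]
      refine (a.toLinearMap.map_smul _ _).trans (congrArg _ ?_)
      exact LinearMap.congr_fun (a.isIntertwining' g) v with
    invFun := a.symm
    left_inv := a.left_inv
    right_inv := a.right_inv }

/-- Representations with isomorphic inflations are isomorphic. -/
theorem InflatedModule.nonempty_equiv {ρ : Representation ℂ G V} {τ : Representation ℂ G W}
    (a : InflatedModule ρ ≃ₗ[SkewGroupAlgebra G] InflatedModule τ) : Nonempty (ρ.Equiv τ) := by
  have hc : ∀ (c : ℂ) (v : InflatedModule ρ), a (c • v) = c • a v := fun c v => by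
    rw [← InflatedModule.algebraMap_smul, ← InflatedModule.algebraMap_smul, map_smul]
  have hg : ∀ (g : G) (v : InflatedModule ρ),
      a (show InflatedModule ρ from ρ g v) = (show InflatedModule τ from τ g (a v)) := fun g v => by
    rw [← InflatedModule.group_smul, ← InflatedModule.group_smul, map_smul]
  exact ⟨.mk { a.toAddEquiv with map_smul' := hc } fun g => LinearMap.ext (hg g)⟩

end Modules

section Projective

variable {m : ℕ} {G : Subgroup (GL (Fin m) ℂ)} {V W : Type} [AddCommGroup V] [Module ℂ V]
  [AddCommGroup W] [Module ℂ W]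

local notation "Λ" => ExteriorAlgebra ℂ (Fin m → ℂ)

/-! ### Induced modules are finitely generated projective -/

/-- The map `x ⊗ v ↦ ∑ g, c(g⁻¹ v) x g` for a linear form `c`. -/
def averagingAux [Fintype G] (ρ : Representation ℂ G V) (c : V →ₗ[ℂ] ℂ) :
    Λ ⊗[ℂ] V →ₗ[ℂ] SkewGroupAlgebra G :=
  TensorProduct.lift <| LinearMap.mk₂ ℂ
    (fun x v => ∑ g : G, SkewMonoidAlgebra.single g (c (ρ g⁻¹ v) • x))
    (fun x y v => by simp [SkewMonoidAlgebra.single_add, Finset.sum_add_distrib])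
    (fun a x v => by
      simp only [Finset.smul_sum, SkewMonoidAlgebra.smul_single, smul_comm a])
    (fun x v w => by
      simp [SkewMonoidAlgebra.single_add, Finset.sum_add_distrib, add_smul])
    (fun a x v => by
      simp [Finset.smul_sum, SkewMonoidAlgebra.smul_single, mul_smul])

theorem averagingAux_tmul [Fintype G] (ρ : Representation ℂ G V) (c : V →ₗ[ℂ] ℂ) (x : Λ) (v : V) :
    averagingAux ρ c (x ⊗ₜ v) = ∑ g : G, SkewMonoidAlgebra.single g (c (ρ g⁻¹ v) • x) :=
  rfl

/-- The map `x ⊗ v ↦ ∑ g, c(g⁻¹ v) x g` as a linear map over the skew group algebra. -/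
def averaging [Fintype G] (ρ : Representation ℂ G V) (c : V →ₗ[ℂ] ℂ) :
    InducedModule ρ →ₗ[SkewGroupAlgebra G] SkewGroupAlgebra G :=
  skewLinearMap (averagingAux ρ c).toAddMonoidHom fun h y p => by
    have key : ∀ p : Λ ⊗[ℂ] V, averagingAux ρ c (y • ((exteriorRep G).tprod ρ h p)) =
        SkewMonoidAlgebra.single h y * averagingAux ρ c p := fun p => by
      induction p with
      | zero => simp
      | tmul x v =>
        have h1 : y • (exteriorRep G).tprod ρ h (x ⊗ₜ[ℂ] v) = (y * h • x) ⊗ₜ[ℂ] ρ h v := rfl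
        rw [h1, averagingAux_tmul, averagingAux_tmul, Finset.mul_sum]
        -- Left multiplication by h is absorbed by the substitution g ↦ hg.
        refine (Fintype.sum_equiv (Equiv.mulLeft h) _ _ fun g => ?_).symm
        have h2 : h • (c (ρ g⁻¹ v) • x) = c (ρ g⁻¹ v) • h • x := (exteriorRep G h).map_smul _ _
        have h3 : ρ (h * g)⁻¹ (ρ h v) = ρ g⁻¹ v := by
          rw [← Module.End.mul_apply, ← map_mul]
          simp
        rw [SkewMonoidAlgebra.single_mul_single, h2, mul_smul_comm, Equiv.coe_mulLeft, h3]
      | add p q hp hq => rw [map_add, smul_add, map_add, hp, hq, map_add, mul_add]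
    rw [InducedModule.single_smul]
    exact key p

theorem averaging_tmul [Fintype G] (ρ : Representation ℂ G V) (c : V →ₗ[ℂ] ℂ) (x : Λ) (v : V) :
    averaging ρ c (InducedModule.tmul ρ x v) =
      ∑ g : G, SkewMonoidAlgebra.single g (c (ρ g⁻¹ v) • x) :=
  rfl

/-- The map from a free module given by a finite family of vectors of `V`. -/
def fromFree {κ : Type} [Fintype κ] (ρ : Representation ℂ G V) (b : κ → V) :
    (κ → SkewGroupAlgebra G) →ₗ[SkewGroupAlgebra G] InducedModule ρ :=
  Fintype.linearCombination (SkewGroupAlgebra G) fun k => InducedModule.tmul ρ 1 (b k)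

/-- Maschke's averaging: for each g the basis expansion of ρ(g⁻¹)v is carried back to v by ρ(g), so
the sum gives v once per group element, and |G| is invertible in ℂ. The induced module is thus a
summand of a finite free module. -/
theorem fromFree_averaging [Fintype G] {κ : Type} [Fintype κ] (ρ : Representation ℂ G V)
    (b : Module.Basis κ ℂ V) (p : InducedModule ρ) :
    fromFree ρ b (fun k => averaging ρ (((Fintype.card G : ℂ)⁻¹) • b.coord k) p) = p := by
  have key : ∀ (x : Λ) (v : V), fromFree ρ b
      (fun k => averaging ρ (((Fintype.card G : ℂ)⁻¹) • b.coord k) (InducedModule.tmul ρ x v)) =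
      InducedModule.tmul ρ x v := fun x v => by
    have h1 : ∀ (g : G) (k : κ) (a : ℂ),
        (SkewMonoidAlgebra.single g (a • x) : SkewGroupAlgebra G) • InducedModule.tmul ρ 1 (b k) =
          (x ⊗ₜ[ℂ] (ρ g (a • b k)) : Λ ⊗[ℂ] V) := fun g k a => by
      rw [InducedModule.single_smul_tmul, smul_one, mul_one, map_smul]
      exact TensorProduct.smul_tmul _ _ _
    simp only [fromFree, Fintype.linearCombination_apply, averaging_tmul, Finset.sum_smul, h1]
    have h2 : (∑ k : κ, ∑ g : G, (x ⊗ₜ[ℂ] (ρ g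
        ((((Fintype.card G : ℂ)⁻¹) • b.coord k) (ρ g⁻¹ v) • b k)) : Λ ⊗[ℂ] V)) = x ⊗ₜ v := by
      rw [Finset.sum_comm]
      simp only [← TensorProduct.tmul_sum, ← map_sum]
      have h3 : ∀ g : G, ∑ k, (((Fintype.card G : ℂ)⁻¹) • b.coord k) (ρ g⁻¹ v) • b k =
          (Fintype.card G : ℂ)⁻¹ • ρ g⁻¹ v := fun g => by
        simp only [LinearMap.smul_apply, smul_assoc, ← Finset.smul_sum, b.coord_apply, b.sum_repr]
      have h4 : ∀ g : G, ρ g (ρ g⁻¹ v) = v := fun g => by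
        rw [← Module.End.mul_apply, ← map_mul]
        simp
      have hcard : (Fintype.card G : ℂ) ≠ 0 := by simp
      simp only [h3, map_smul, h4, Finset.sum_const, Finset.card_univ]
      rw [← Nat.cast_smul_eq_nsmul ℂ, smul_smul, mul_inv_cancel₀ hcard, one_smul]
    exact h2
  have add : ∀ p q : InducedModule ρ,
      fromFree ρ b (fun k => averaging ρ (((Fintype.card G : ℂ)⁻¹) • b.coord k) p) = p →
      fromFree ρ b (fun k => averaging ρ (((Fintype.card G : ℂ)⁻¹) • b.coord k) q) = q →
      fromFree ρ b (fun k => averaging ρ (((Fintype.card G : ℂ)⁻¹) • b.coord k) (p + q)) =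
        p + q := fun p q hp hq => by
    conv_rhs => rw [← hp, ← hq, ← map_add]
    congr 1
    funext k
    exact map_add _ _ _
  exact TensorProduct.induction_on (R := ℂ) (M := Λ) (N := V)
    (motive := fun p => fromFree ρ b
      (fun k => averaging ρ (((Fintype.card G : ℂ)⁻¹) • b.coord k) p) = p) p
    (by
      have : (fun k => averaging ρ (((Fintype.card G : ℂ)⁻¹) • b.coord k) (0 : InducedModule ρ)) =
        0 := funext fun k => map_zero _
      exact (congrArg _ this).trans (map_zero _)) key add

instance InducedModule.finite [Finite G] [FiniteDimensional ℂ V] (ρ : Representation ℂ G V) :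
    Module.Finite (SkewGroupAlgebra G) (InducedModule ρ) := by
  have := Fintype.ofFinite G
  exact Module.Finite.of_surjective (fromFree ρ (Module.finBasis ℂ V))
    fun p => ⟨_, fromFree_averaging ρ _ p⟩

instance InducedModule.projective [Finite G] [FiniteDimensional ℂ V] (ρ : Representation ℂ G V) :
    Module.Projective (SkewGroupAlgebra G) (InducedModule ρ) := by
  have := Fintype.ofFinite G
  exact Module.Projective.of_split
    (LinearMap.pi fun k => averaging ρ (((Fintype.card G : ℂ)⁻¹) • (Module.finBasis ℂ V).coord k))
    (fromFree ρ (Module.finBasis ℂ V))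
    (LinearMap.ext fun p => fromFree_averaging ρ (Module.finBasis ℂ V) p)

end Projective

/-! ### The Nakayama permutation -/

section Nakayama

variable {m : ℕ} {G : Subgroup (GL (Fin m) ℂ)} {V : Type} [AddCommGroup V] [Module ℂ V]

/-- Two nonzero complementary summands would both contain the top degree part. Indecomposability is
what allows completeness of the basic system to be applied. -/
theorem InducedModule.isIndecomposableModule (ρ : Representation ℂ G V) [hρ : ρ.IsIrreducible] :
    IsIndecomposableModule (SkewGroupAlgebra G) (InducedModule ρ) := by
  refine isIndecomposableModule_of_essential (T := LinearMap.range (InducedModule.ofTop ρ)) ?_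
    (InducedModule.range_ofTop_le ρ)
  have := IsSimpleModule.nontrivial (SkewGroupAlgebra G) (InflatedModule ρ)
  obtain ⟨v, hv⟩ := exists_ne (0 : InflatedModule ρ)
  intro h
  rw [LinearMap.range_eq_bot] at h
  exact hv (InducedModule.ofTop_injective ρ (LinearMap.congr_fun h v |>.trans (map_zero _).symm))

variable [Finite G] {ι : Type} [Fintype ι] {e : ι → SkewGroupAlgebra G} (he : IsBasicSystem e)

theorem nontrivial_cornerSubgroup_inflated (he : IsBasicSystem e) (i : Irr G) :
    Nontrivial (cornerSubgroup (∑ k, e k) (InflatedModule i.rep.ρ)) := by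
  have := IsSimpleModule.nontrivial (SkewGroupAlgebra G) (InflatedModule i.rep.ρ)
  exact he.nontrivial_cornerSubgroup (InducedModule.isIndecomposableModule i.rep.ρ)
    (InducedModule.toInflated_surjective i.rep.ρ)

/-- The permutation `det ⊗ -` is a Nakayama permutation. -/
theorem isNakayamaPermutation_twist :
    IsNakayamaPermutation (vertexSimple he) (Irr.twist (detChar G)) := by
  intro i
  have hP := InducedModule.isIndecomposableModule i.rep.ρ
  have hπ := InducedModule.toInflated_surjective i.rep.ρ
  have hidem := he.isIdempotentElem
  let π := cornerMap hidem (InducedModule.toInflated i.rep.ρ)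
  have hcover : IsProjectiveCover π :=
    ⟨he.projective_cornerSubgroup hP, cornerMap_surjective hidem hπ,
      cornerMap_superfluous hidem (nontrivial_cornerSubgroup_inflated he i) hπ
        (InducedModule.ker_toInflated_superfluous i.rep.ρ)⟩
  -- The representative of the twisted class and the twist of the representative are only
  -- isomorphic; a compares them.
  obtain ⟨a⟩ := IrrRep.cls_eq_iff.mp
    ((Irr.cls_rep (Irr.twist (detChar G) i)).trans (Irr.cls_twist_rep (detChar G) i).symm)
  let a' := InflatedModule.congr a
  have hsocle := nonempty_moduleSocle_cornerSubgroup_equiv hidem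
    (nontrivial_cornerSubgroup_inflated he (Irr.twist (detChar G) i))
    (τ := InducedModule.ofTop i.rep.ρ ∘ₗ a'.toLinearMap)
    ((InducedModule.ofTop_injective i.rep.ρ).comp a'.injective) fun X hX =>
      (LinearMap.range_comp_le_range _ _).trans (InducedModule.range_ofTop_le i.rep.ρ X hX)
  exact ⟨ModuleCat.of _ (cornerSubgroup (∑ k, e k) (InducedModule i.rep.ρ)), π, hcover, hsocle⟩

theorem eq_of_vertexSimple_equiv {i j : Irr G}
    (E : vertexSimple he i ≃ₗ[he.basicAlgebra] vertexSimple he j) : i = j := by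
  let E' : cornerSubgroup (∑ k, e k) (InflatedModule i.rep.ρ) ≃ₗ[he.basicAlgebra]
    cornerSubgroup (∑ k, e k) (InflatedModule j.rep.ρ) := E
  obtain ⟨a⟩ := he.nonempty_equiv_of_corner_equiv
    (InducedModule.isIndecomposableModule i.rep.ρ)
    (InducedModule.toInflated_surjective i.rep.ρ)
    (InducedModule.ker_toInflated_superfluous i.rep.ρ) E'
  exact Irr.rep_equiv_iff.mp (InflatedModule.nonempty_equiv a)

/-- Two projective covers of the same simple module are isomorphic, hence so are their socles, and a
vertex is determined by its simple module. -/
theorem IsNakayamaPermutation.unique {σ τ : Equiv.Perm (Irr G)}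
    (hσ : IsNakayamaPermutation (vertexSimple he) σ)
    (hτ : IsNakayamaPermutation (vertexSimple he) τ) : σ = τ := by
  refine Equiv.ext fun i => ?_
  obtain ⟨P, π, hπ, ⟨a⟩⟩ := hσ i
  obtain ⟨P', π', hπ', ⟨a'⟩⟩ := hτ i
  obtain ⟨b⟩ := hπ.nonempty_equiv hπ'
  exact eq_of_vertexSimple_equiv he (a.symm.trans ((moduleSocleCongr b).trans a'))

end Nakayama

end

/-! ### The main theorem. -/

theorem mainTheorem5 (m : ℕ) (G' : Subgroup (GL (Fin m) ℂ)) [Finite G']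
    {ι : Type} [Fintype ι] (e : ι → SkewGroupAlgebra G') (he : IsBasicSystem e) :
    (∃! σ : Equiv.Perm (Irr G'), IsNakayamaPermutation (vertexSimple he) σ) ∧
    ∀ σ : Equiv.Perm (Irr G'), IsNakayamaPermutation (vertexSimple he) σ →
      ∃ F : QuiverIso (mckayQuiver (embeddedImage G')) ((mckayQuiver G').addArrows σ),
        F.onVertices = Irr.pullback (embeddedImageEquiv G') := by
  have h := isNakayamaPermutation_twist he
  refine ⟨⟨_, h, fun σ hσ => hσ.unique he h⟩, fun σ hσ => ?_⟩
  -- By uniqueness an arbitrary Nakayama permutation is the twist by det, for which the arrows have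
  -- been counted.
  rw [hσ.unique he h]
  exact exists_quiverIso_addArrows_twist G'
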